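/- Let $N\ge 1$, $\mathbb{T}^n=\mathbb{R}^n/2\pi\mathbb{Z}^n$, let $C^\infty(\mathbb{T}^n)$ be the space of smooth complex-valued functions on $\mathbb{T}^n$ with its usual Fréchet topology (uniform convergence of all derivatives), and let $\mathcal{D}'(\mathbb{T}^n)$ be its dual. An operator $P$ is called globally hypoelliptic (GH) on $\mathbb{T}^n$ if $u\in\mathcal{D}'(\mathbb{T}^n)$ and $Pu\in C^\infty(\mathbb{T}^n)$ imply $u\in C^\infty(\mathbb{T}^n)$. Write $D=-i\partial$, and let $$L=D_t+\sum_{j=1}^N c_j(t)D_{x_j},\qquad (t,x_1,\dots,x_N)\in\mathbb{T}^{N+1},\qquad c_j\in C^\infty(\mathbb{T}^1)\ \text{complex-valued}.$$ Put $c_{j0}=\frac1{2\pi}\int_0^{2\pi}c_j$, $L_{00}=D_t+\sum_{j=1}^N c_{j0}D_{x_j}$ and, for $\lambda\in C^\infty(\mathbb{T}^{N+1})$, $\lambda_0=\frac{1}{(2\pi)^{N+1}}\int_{\mathbb{T}^{N+1}}\lambda$. Define $$\mathcal{O}=\{\lambda\in C^\infty(\mathbb{T}^{N+1}):\ L-\lambda\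 \text{is not GH}\},\qquad G=\{\lambda\in C^\infty(\mathbb{T}^{N+1}):\ L_{00}-\lambda_0\ \text{is not GH}\}.$$ Then: - If $L$ is globally hypoelliptic, then $G\subset\mathcal{O}$. - (i) If $\Im c_{j0}=0$ for every $j$ and $c_{k0}\in\mathbb{R}\setminus\mathbb{Q}$ for some $k$, then $G$ is contained in $F=\{\lambda\in C^\infty(\mathbb{T}^{N+1}):\ \Im\lambda_0=0\}$ and is a dense $G_\delta$ subset of $F$. - (ii) If there is $k$ such that $\Im c_{k0}\neq0$ and $$\{r\in\mathbb{Q}^2:\ (\Im c_{k0})^{-1}C^{T}r\in\mathbb{Q}^{N-1}\}=\{(0,0)\},$$ where $C$ is the real $2\times(N-1)$ matrix with entries $C_{1j}=\Re c_{j0}\,\Im c_{k0}-\Re c_{k0}\,\Im c_{j0}$ and $C_{2j}=\Im c_{j0}$, $j\in\{1,\dots,N\}\setminus\{k\}$, then $G$ is a dense $G_\delta$ subset of $C^\infty(\mathbb{T}^{N+1})$. -/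

import Mathlib

open scoped ContDiff NNReal

noncomputable section

/-! ### Smooth functions on the torus `𝕋ⁿ = ℝⁿ / 2πℤⁿ` -/

/-- The smooth `2πℤⁿ`-periodic complex-valued functions on `ℝⁿ`, as an algebra. -/
def smoothPeriodicSubalgebra (n : ℕ) : Subalgebra ℂ ((Fin n → ℝ) → ℂ) where
  carrier := {f | ContDiff ℝ ∞ f ∧
    ∀ m : Fin n → ℤ, Function.Periodic f (fun i => 2 * Real.pi * (m i : ℝ))}
  mul_mem' := by
    rintro f g ⟨hf, hf'⟩ ⟨hg, hg'⟩
    exact ⟨hf.mul hg, fun m => (hf' m).mul (hg' m)⟩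
  add_mem' := by
    rintro f g ⟨hf, hf'⟩ ⟨hg, hg'⟩
    exact ⟨hf.add hg, fun m => (hf' m).add (hg' m)⟩
  algebraMap_mem' := fun z => ⟨contDiff_const, fun _ _ => rfl⟩

/-- `C^∞(𝕋ⁿ)`. This is a type synonym, so that it does not inherit the topology of pointwise
convergence; it gets its Fréchet topology below. -/
def TorusSmooth (n : ℕ) : Type := smoothPeriodicSubalgebra n

namespace TorusSmooth

variable {n : ℕ}

instance : CommRing (TorusSmooth n) := inferInstanceAs (CommRing (smoothPeriodicSubalgebra n))

instance : Algebra ℂ (TorusSmooth n) := inferInstanceAs (Algebra ℂ (smoothPeriodicSubalgebra n))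

instance : FunLike (TorusSmooth n) (Fin n → ℝ) ℂ where
  coe f := f.1
  coe_injective _ _ h := Subtype.ext h

/-- Build an element of `C^∞(𝕋ⁿ)` from a smooth periodic function. -/
def mk (f : (Fin n → ℝ) → ℂ) (hf : ContDiff ℝ ∞ f)
    (hp : ∀ m : Fin n → ℤ, Function.Periodic f (fun i => 2 * Real.pi * (m i : ℝ))) :
    TorusSmooth n := ⟨f, hf, hp⟩

@[simp] theorem mk_apply (f : (Fin n → ℝ) → ℂ) (hf) (hp) (x : Fin n → ℝ) :
    (mk f hf hp : TorusSmooth n) x = f x := rfl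

@[ext] theorem ext {f g : TorusSmooth n} (h : ∀ x, f x = g x) : f = g :=
  DFunLike.ext f g h

theorem contDiff (f : TorusSmooth n) : ContDiff ℝ ∞ f := f.2.1

theorem periodic (f : TorusSmooth n) (m : Fin n → ℤ) :
    Function.Periodic f (fun i => 2 * Real.pi * (m i : ℝ)) := f.2.2 m

@[simp] theorem add_apply (f g : TorusSmooth n) (x : Fin n → ℝ) : (f + g) x = f x + g x := rfl
@[simp] theorem mul_apply (f g : TorusSmooth n) (x : Fin n → ℝ) : (f * g) x = f x * g x := rfl
@[simp] theorem neg_apply (f : TorusSmooth n) (x : Fin n → ℝ) : (-f) x = -f x := rfl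
@[simp] theorem sub_apply (f g : TorusSmooth n) (x : Fin n → ℝ) : (f - g) x = f x - g x := rfl
@[simp] theorem zero_apply (x : Fin n → ℝ) : (0 : TorusSmooth n) x = 0 := rfl
@[simp] theorem one_apply (x : Fin n → ℝ) : (1 : TorusSmooth n) x = 1 := rfl
@[simp] theorem smul_apply (z : ℂ) (f : TorusSmooth n) (x : Fin n → ℝ) : (z • f) x = z * f x := rfl
@[simp] theorem algebraMap_apply (z : ℂ) (x : Fin n → ℝ) :
    (algebraMap ℂ (TorusSmooth n) z) x = z := rfl

theorem iteratedFDeriv_periodic (f : TorusSmooth n) (k : ℕ) (m : Fin n → ℤ) :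
    Function.Periodic (iteratedFDeriv ℝ k f) (fun i => 2 * Real.pi * (m i : ℝ)) := by
  intro x
  have h := iteratedFDeriv_comp_add_right (𝕜 := ℝ) (f := (f : (Fin n → ℝ) → ℂ)) k
    (fun i => 2 * Real.pi * (m i : ℝ)) x
  rw [← h]
  congr 1
  funext y
  exact f.periodic m y

theorem bddAbove_iteratedFDeriv (f : TorusSmooth n) (k : ℕ) :
    BddAbove (Set.range fun x => ‖iteratedFDeriv ℝ k f x‖) := by
  have hc : Continuous fun x => ‖iteratedFDeriv ℝ k f x‖ :=
    (f.contDiff.continuous_iteratedFDeriv (m := k) (by exact_mod_cast le_top)).norm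
  have hK : IsCompact (Set.Icc (0 : Fin n → ℝ) (fun _ => 2 * Real.pi)) := isCompact_Icc
  obtain ⟨C, hC⟩ := hK.bddAbove_image hc.continuousOn
  refine ⟨C, ?_⟩
  rintro _ ⟨x, rfl⟩
  have hpi : (0 : ℝ) < 2 * Real.pi := by positivity
  have hper := f.iteratedFDeriv_periodic k (fun i => -⌊x i / (2 * Real.pi)⌋) x
  have hmem : (x + fun i => 2 * Real.pi * ((-⌊x i / (2 * Real.pi)⌋ : ℤ) : ℝ)) ∈
      Set.Icc (0 : Fin n → ℝ) (fun _ => 2 * Real.pi) := by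
    constructor
    · intro i
      have h1 := Int.floor_le (x i / (2 * Real.pi))
      rw [le_div_iff₀ hpi] at h1
      simp only [Pi.zero_apply, Pi.add_apply, Int.cast_neg]
      linarith
    · intro i
      have h1 := (Int.lt_floor_add_one (x i / (2 * Real.pi))).le
      rw [div_le_iff₀ hpi] at h1
      simp only [Pi.add_apply, Int.cast_neg]
      linarith
  have := hC (Set.mem_image_of_mem _ hmem)
  simp only [hper] at this
  exact this

/-- The seminorm `p_k(f) = sup_x ‖D^k f(x)‖`. -/
def seminorm (n k : ℕ) : Seminorm ℂ (TorusSmooth n) :=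
  Seminorm.of (fun f => ⨆ x, ‖iteratedFDeriv ℝ k f x‖)
    (fun f g => by
      refine ciSup_le fun x => ?_
      have e : iteratedFDeriv ℝ k (f + g : TorusSmooth n) x =
          iteratedFDeriv ℝ k f x + iteratedFDeriv ℝ k g x :=
        iteratedFDeriv_add_apply (f.contDiff.of_le (by exact_mod_cast le_top)).contDiffAt
          (g.contDiff.of_le (by exact_mod_cast le_top)).contDiffAt
      rw [e]
      exact (norm_add_le _ _).trans
        (add_le_add (le_ciSup (f.bddAbove_iteratedFDeriv k) x)
          (le_ciSup (g.bddAbove_iteratedFDeriv k) x)))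
    (fun z f => by
      rw [Real.mul_iSup_of_nonneg (norm_nonneg z)]
      refine iSup_congr fun x => ?_
      have e : iteratedFDeriv ℝ k (z • f : TorusSmooth n) x = z • iteratedFDeriv ℝ k f x :=
        iteratedFDeriv_const_smul_apply
          (f.contDiff.of_le (by exact_mod_cast le_top)).contDiffAt
      rw [e, norm_smul])

theorem le_seminorm (k : ℕ) (f : TorusSmooth n) (x : Fin n → ℝ) :
    ‖iteratedFDeriv ℝ k f x‖ ≤ seminorm n k f :=
  le_ciSup (f.bddAbove_iteratedFDeriv k) x

theorem seminorm_le_of_forall (k : ℕ) (f : TorusSmooth n) (C : ℝ)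
    (h : ∀ x, ‖iteratedFDeriv ℝ k f x‖ ≤ C) : seminorm n k f ≤ C :=
  ciSup_le h

theorem norm_apply_le (f : TorusSmooth n) (x : Fin n → ℝ) : ‖f x‖ ≤ seminorm n 0 f := by
  simpa using le_seminorm 0 f x

/-- The usual metrizable topology of `C^∞(𝕋ⁿ)`: uniform convergence of all derivatives. -/
instance : TopologicalSpace (TorusSmooth n) :=
  (SeminormFamily.moduleFilterBasis (𝕜 := ℂ) (seminorm n)).topology

theorem withSeminorms (n : ℕ) : WithSeminorms (𝕜 := ℂ) (seminorm n) := ⟨rfl⟩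

instance : IsTopologicalAddGroup (TorusSmooth n) := (withSeminorms n).topologicalAddGroup

instance : ContinuousSMul ℂ (TorusSmooth n) := (withSeminorms n).continuousSMul

/-! ### Derivatives, products and means -/

/-- The operator `D_j = -i ∂_j` on smooth functions. -/
def Dlin (j : Fin n) : TorusSmooth n →ₗ[ℂ] TorusSmooth n where
  toFun f := mk (fun x => -Complex.I * fderiv ℝ f x (Pi.single j 1))
    (contDiff_const.mul ((f.contDiff.fderiv_right (m := ∞) (by simp)).clm_apply contDiff_const))
    (fun m x => by
      have h := fderiv_comp_add_right (𝕜 := ℝ) (f := (f : (Fin n → ℝ) → ℂ)) (x := x)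
        (fun i => 2 * Real.pi * (m i : ℝ))
      have e : (fun y => f (y + fun i => 2 * Real.pi * (m i : ℝ))) = f := funext (f.periodic m)
      rw [e] at h
      simp only [h])
  map_add' f g := by
    ext x
    have hf : DifferentiableAt ℝ f x := f.contDiff.differentiable (by simp) x
    have hg : DifferentiableAt ℝ g x := g.contDiff.differentiable (by simp) x
    have e : fderiv ℝ (f + g : TorusSmooth n) x = fderiv ℝ f x + fderiv ℝ g x := fderiv_add hf hg
    change -Complex.I * fderiv ℝ (f + g : TorusSmooth n) x (Pi.single j 1) =
      -Complex.I * fderiv ℝ f x (Pi.single j 1) + -Complex.I * fderiv ℝ g x (Pi.single j 1)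
    rw [e, _root_.add_apply, mul_add]
  map_smul' z f := by
    ext x
    have hf : DifferentiableAt ℝ f x := f.contDiff.differentiable (by simp) x
    have e : fderiv ℝ (z • f : TorusSmooth n) x = z • fderiv ℝ f x := fderiv_const_smul hf z
    change -Complex.I * fderiv ℝ (z • f : TorusSmooth n) x (Pi.single j 1) =
      z * (-Complex.I * fderiv ℝ f x (Pi.single j 1))
    rw [e, _root_.smul_apply, smul_eq_mul]
    ring

theorem seminorm_Dlin_le (j : Fin n) (k : ℕ) (f : TorusSmooth n) :
    seminorm n k (Dlin j f) ≤ seminorm n (k + 1) f := by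
  refine seminorm_le_of_forall _ _ _ fun x => ?_
  have hd : ContDiff ℝ ∞ (fderiv ℝ f) := f.contDiff.fderiv_right (m := ∞) (by simp)
  have hd' : ContDiff ℝ ∞ (fun y => fderiv ℝ f y (Pi.single j 1)) := hd.clm_apply contDiff_const
  have e : iteratedFDeriv ℝ k (Dlin j f) x =
      (-Complex.I) • iteratedFDeriv ℝ k (fun y => fderiv ℝ f y (Pi.single j 1)) x :=
    iteratedFDeriv_const_smul_apply (a := -Complex.I)
      (f := fun y => fderiv ℝ f y (Pi.single j 1)) (hd'.of_le (by exact_mod_cast le_top)).contDiffAt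
  have h1 : ‖iteratedFDeriv ℝ k (fun y => fderiv ℝ f y (Pi.single j 1)) x‖ ≤
      ‖(Pi.single j 1 : Fin n → ℝ)‖ * ‖iteratedFDeriv ℝ k (fderiv ℝ f) x‖ :=
    norm_iteratedFDeriv_clm_apply_const (N := ∞) hd.contDiffAt (by exact_mod_cast le_top)
  rw [e, norm_smul, norm_neg, Complex.norm_I, one_mul]
  refine h1.trans ?_
  rw [norm_iteratedFDeriv_fderiv, Pi.norm_single, norm_one, one_mul]
  exact le_seminorm _ f x

/-- The operator `D_j = -i ∂_j`, as a continuous operator on `C^∞(𝕋ⁿ)`. -/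
def D (j : Fin n) : TorusSmooth n →L[ℂ] TorusSmooth n where
  toLinearMap := Dlin j
  cont := WithSeminorms.continuous_of_isBounded (withSeminorms n) (withSeminorms n) _ fun k =>
    ⟨{k + 1}, 1, fun f => by simpa using seminorm_Dlin_le j k f⟩

theorem D_apply (j : Fin n) (f : TorusSmooth n) (x : Fin n → ℝ) :
    D j f x = -Complex.I * fderiv ℝ f x (Pi.single j 1) := rfl

theorem seminorm_mul_le (k : ℕ) (a f : TorusSmooth n) :
    seminorm n k (a * f) ≤
      ∑ i ∈ Finset.range (k + 1), (k.choose i : ℝ) * seminorm n i a * seminorm n (k - i) f := by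
  refine seminorm_le_of_forall _ _ _ fun x => ?_
  refine (norm_iteratedFDeriv_mul_le (N := ∞) a.contDiff f.contDiff x
    (by exact_mod_cast le_top)).trans (Finset.sum_le_sum fun i _ => ?_)
  gcongr
  · exact le_seminorm i a x
  · exact le_seminorm (k - i) f x

/-- Multiplication by `a`, as a continuous operator on `C^∞(𝕋ⁿ)`. -/
def mulCLM (a : TorusSmooth n) : TorusSmooth n →L[ℂ] TorusSmooth n where
  toLinearMap := LinearMap.mulLeft ℂ a
  cont := WithSeminorms.continuous_of_isBounded (withSeminorms n) (withSeminorms n) _ fun k => by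
    refine ⟨Finset.range (k + 1),
      ∑ i ∈ Finset.range (k + 1), (k.choose i : ℝ≥0) * ⟨seminorm n i a, apply_nonneg _ _⟩,
      fun f => ?_⟩
    refine (seminorm_mul_le k a f).trans ?_
    simp only [_root_.smul_apply, NNReal.smul_def, smul_eq_mul, NNReal.coe_sum, Finset.sum_mul]
    refine Finset.sum_le_sum fun i hi => ?_
    have h : seminorm n (k - i) f ≤ (Finset.range (k + 1)).sup (seminorm n) f :=
      Seminorm.le_def.1 (Finset.le_sup (f := seminorm n)
        (Finset.mem_range.2 (Nat.lt_succ_of_le (Nat.sub_le k i)))) f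
    exact mul_le_mul_of_nonneg_left h (mul_nonneg (Nat.cast_nonneg _) (apply_nonneg _ _))

@[simp] theorem mulCLM_apply (a f : TorusSmooth n) : mulCLM a f = a * f := rfl

/-- The mean `(2π)⁻ⁿ ∫_{𝕋ⁿ} f`. -/
def mean (f : TorusSmooth n) : ℂ :=
  (((2 * Real.pi) ^ n : ℝ) : ℂ)⁻¹ * ∫ x in Set.Icc (0 : Fin n → ℝ) (fun _ => 2 * Real.pi), f x

/-- A function `a(t)` on `𝕋¹`, regarded as the function `(t, x₁, …, x_N) ↦ a(t)` on `𝕋^{N+1}`. -/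
def ofTime {N : ℕ} (a : TorusSmooth 1) : TorusSmooth (N + 1) :=
  mk (fun x => a (fun _ => x 0))
    (a.contDiff.comp (contDiff_pi.2 fun _ => contDiff_apply ℝ ℝ 0))
    (fun m x => a.periodic (fun _ => m 0) (fun _ => x 0))

end TorusSmooth

/-! ### Periodic distributions -/

/-- `𝓓'(𝕋ⁿ)`, the dual of `C^∞(𝕋ⁿ)`. -/
abbrev TorusDistribution (n : ℕ) : Type := TorusSmooth n →L[ℂ] ℂ

namespace TorusDistribution

variable {n : ℕ}

/-- `D_j = -i ∂_j` on distributions: `⟨D_j u, φ⟩ = -⟨u, D_j φ⟩`. -/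
def D (j : Fin n) (u : TorusDistribution n) : TorusDistribution n := -(u.comp (TorusSmooth.D j))

/-- The product of a smooth function and a distribution: `⟨a u, φ⟩ = ⟨u, a φ⟩`. -/
def mul (a : TorusSmooth n) (u : TorusDistribution n) : TorusDistribution n :=
  u.comp (TorusSmooth.mulCLM a)

theorem integrableOn_mul (f φ : TorusSmooth n) :
    MeasureTheory.IntegrableOn (fun x => f x * φ x)
      (Set.Icc (0 : Fin n → ℝ) (fun _ => 2 * Real.pi)) :=
  (f.contDiff.continuous.mul φ.contDiff.continuous).continuousOn.integrableOn_compact isCompact_Icc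

/-- The linear functional `φ ↦ ∫_{𝕋ⁿ} f φ`. -/
def ofSmoothLin (f : TorusSmooth n) : TorusSmooth n →ₗ[ℂ] ℂ where
  toFun φ := ∫ x in Set.Icc (0 : Fin n → ℝ) (fun _ => 2 * Real.pi), f x * φ x
  map_add' φ ψ := by
    rw [← MeasureTheory.integral_add (integrableOn_mul f φ) (integrableOn_mul f ψ)]
    simp only [TorusSmooth.add_apply, mul_add]
  map_smul' z φ := by
    rw [RingHom.id_apply, smul_eq_mul, ← MeasureTheory.integral_const_mul]
    refine MeasureTheory.integral_congr_ae (Filter.Eventually.of_forall fun x => ?_)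
    simp only [TorusSmooth.smul_apply]
    ring

/-- The distribution `φ ↦ ∫_{𝕋ⁿ} f φ` given by a smooth function `f`. -/
def ofSmooth (f : TorusSmooth n) : TorusDistribution n where
  toLinearMap := ofSmoothLin f
  cont := by
    refine WithSeminorms.continuous_normedSpace_rng ℂ (TorusSmooth.withSeminorms n) _
      ⟨{0}, ⟨TorusSmooth.seminorm n 0 f *
        MeasureTheory.volume.real (Set.Icc (0 : Fin n → ℝ) (fun _ => 2 * Real.pi)),
        mul_nonneg (apply_nonneg _ _) MeasureTheory.measureReal_nonneg⟩, fun φ => ?_⟩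
    have h := MeasureTheory.norm_setIntegral_le_of_norm_le_const (μ := MeasureTheory.volume)
      (s := Set.Icc (0 : Fin n → ℝ) (fun _ => 2 * Real.pi)) (f := fun x => f x * φ x)
      (C := TorusSmooth.seminorm n 0 f * TorusSmooth.seminorm n 0 φ)
      isCompact_Icc.measure_lt_top (fun x _ => by
        rw [norm_mul]
        exact mul_le_mul (f.norm_apply_le x) (φ.norm_apply_le x) (norm_nonneg _)
          (apply_nonneg _ _))
    refine h.trans (le_of_eq ?_)
    rw [Finset.sup_singleton]
    exact mul_right_comm _ _ _

end TorusDistribution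

/-- An operator on `𝓓'(𝕋ⁿ)` is globally hypoelliptic if `P u ∈ C^∞(𝕋ⁿ)` implies
`u ∈ C^∞(𝕋ⁿ)`, for every distribution `u`. -/
def IsGloballyHypoelliptic {n : ℕ} (P : TorusDistribution n → TorusDistribution n) : Prop :=
  ∀ u : TorusDistribution n, P u ∈ Set.range TorusDistribution.ofSmooth →
    u ∈ Set.range TorusDistribution.ofSmooth

/-! ### Tube-type operators -/

/-- `L = D_t + ∑_j c_j(t) D_{x_j}` on `𝕋^{N+1}`; the variable `t` has index `0` and `x_j` has
index `j.succ`. -/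
def tubeOperator {N : ℕ} (c : Fin N → TorusSmooth 1) (u : TorusDistribution (N + 1)) :
    TorusDistribution (N + 1) :=
  TorusDistribution.D 0 u +
    ∑ j, TorusDistribution.mul (TorusSmooth.ofTime (c j)) (TorusDistribution.D j.succ u)

/-- `P_λ = L - λ`. -/
def perturbedTubeOperator {N : ℕ} (c : Fin N → TorusSmooth 1) (lam : TorusSmooth (N + 1))
    (u : TorusDistribution (N + 1)) : TorusDistribution (N + 1) :=
  tubeOperator c u - TorusDistribution.mul lam u

/-- `𝓞 = {λ ∈ C^∞(𝕋^{N+1}) : L - λ is not GH}`. -/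
def nonGHPerturbations {N : ℕ} (c : Fin N → TorusSmooth 1) : Set (TorusSmooth (N + 1)) :=
  {lam | ¬ IsGloballyHypoelliptic (perturbedTubeOperator c lam)}

/-- The coefficients of `L₀₀`: the constant functions `c_{j0}`, the means of the `c_j`. -/
def averagedCoefficients {N : ℕ} (c : Fin N → TorusSmooth 1) : Fin N → TorusSmooth 1 :=
  fun j => algebraMap ℂ (TorusSmooth 1) (c j).mean

/-- `𝓜_{0N} = {z ∈ ℂ : L₀₀ - z is not GH}`. -/
def averagedNonGHConstants {N : ℕ} (c : Fin N → TorusSmooth 1) : Set ℂ :=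
  {z | ¬ IsGloballyHypoelliptic
    (perturbedTubeOperator (averagedCoefficients c) (algebraMap ℂ (TorusSmooth (N + 1)) z))}

/-- `G = {λ ∈ C^∞(𝕋^{N+1}) : λ₀ ∈ 𝓜_{0N}}`. -/
def meanNonGHPerturbations {N : ℕ} (c : Fin N → TorusSmooth 1) : Set (TorusSmooth (N + 1)) :=
  {lam | lam.mean ∈ averagedNonGHConstants c}

/-- `F = {λ ∈ C^∞(𝕋^{N+1}) : Im λ₀ = 0}`. -/
def realMeanPerturbations (N : ℕ) : Set (TorusSmooth (N + 1)) :=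
  {lam | lam.mean.im = 0}

/-- The `2 × (N-1)` matrix with columns `(Re α_j Im α_k - Re α_k Im α_j, Im α_j)`, `j ≠ k`. -/
def kroneckerMatrix {N : ℕ} (α : Fin N → ℂ) (k : Fin N) : Matrix (Fin 2) {j : Fin N // j ≠ k} ℝ :=
  Matrix.of ![fun j => (α j).re * (α k).im - (α k).re * (α j).im, fun j => (α j).im]

/-- `{r ∈ ℚ² : (Im α_k)⁻¹ Cᵀ r ∈ ℚ^{N-1}} = {0}`. -/
def KroneckerCondition {N : ℕ} (α : Fin N → ℂ) (k : Fin N) : Prop :=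
  {r : Fin 2 → ℚ | ∀ j, ∃ q : ℚ,
    ((α k).im⁻¹ • (kroneckerMatrix α k).transpose.mulVec (fun i => (r i : ℝ))) j = (q : ℝ)} = {0}

end

/-!
The proof goes through Fourier series. A distribution on the torus is smooth as soon as its Fourier
coefficients decay rapidly (`TorusDistribution.mem_range_ofSmooth_of_rapidDecay`), so for constant
coefficients everything is read off from the symbol `τ + ∑_j c_{j0} ξ_j`: the operator `L₀₀ - z`
fails to be globally hypoelliptic exactly when, for every `K`, infinitely many `(τ, ξ) ∈ ℤ^{N+1}`
satisfy `|τ + ∑_j c_{j0} ξ_j - z| < (1 + ‖(τ, ξ)‖)^{-K}`. This is the condition `SmallDenominators`.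

The integrating factors `phase b ξ = exp(∑_j ξ_j b_j(t))`, with `D_t b_j = c_{j0} - c_j`, conjugate
`L`, frequency by frequency in `x`, to `L₀₀`. They may grow exponentially with `ξ`, so this is not a
conjugation of the operators, but after normalisation it still gives eigenfunctions of `L` with
eigenvalue `τ + ∑_j c_{j0} ξ_j`, sup norm one and polynomially bounded derivatives
(`exists_eigenfunctions`). A sum of those belonging to very small values of the symbol minus `z` is
a singular distribution `v` with `(L - z) v` smooth; hence small denominators for `z` also prevent
`L - z` from being globally hypoelliptic (`SmallDenominators.not_isGloballyHypoelliptic`).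

If `L` is globally hypoelliptic, then its range on `C^∞` contains every function of mean zero
(`IsGloballyHypoelliptic.exists_smoothTube_eq`). Hence `L h = λ - λ₀` for some smooth `h`, and
multiplication by `e^h` conjugates `L - λ` to `L - λ₀`, which is not globally hypoelliptic if
`L₀₀ - λ₀` is not. This is the inclusion `G ⊆ 𝓞`.

The set of `z` with small denominators is a countable intersection of open sets, each of which
contains all but finitely many values of the symbol. By Baire's theorem it is dense, in `ℝ` or in
`ℂ`, as soon as the range of the symbol is (`dense_setOf_forall_infinite`). In the real case this
range contains the subgroup generated by `1` and an irrational number. In the complex case its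
density is Kronecker's theorem, proved here by comparing the Haar measure of the torus with that of
a closed subgroup (`dense_of_forall_exists_mFourier_ne_one`). The mean is a continuous map with
continuous sections, so both properties pass to the set of functions `λ`.
-/

noncomputable section

namespace TorusSmooth

variable {n : ℕ}

/-! ### Calculus on the torus -/

theorem D_mul (j : Fin n) (f g : TorusSmooth n) : D j (f * g) = D j f * g + f * D j g := by
  ext x
  have hf : DifferentiableAt ℝ f x := f.contDiff.differentiable (by simp) x
  have hg : DifferentiableAt ℝ g x := g.contDiff.differentiable (by simp) x
  have e : fderiv ℝ (f * g : TorusSmooth n) x = f x • fderiv ℝ g x + g x • fderiv ℝ f x :=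
    fderiv_mul hf hg
  simp only [D_apply, e, add_apply, mul_apply, _root_.add_apply, _root_.smul_apply, smul_eq_mul]
  ring

theorem fderiv_apply_single (f : TorusSmooth n) (x : Fin n → ℝ) (j : Fin n) :
    fderiv ℝ f x (Pi.single j 1) = Complex.I * D j f x := by
  rw [D_apply, ← mul_assoc, mul_neg, Complex.I_mul_I, neg_neg, one_mul]

/-- The real-linear map sending `z` to the linear form `v ↦ i v_j z`. -/
def derivCoord (j : Fin n) : ℂ →L[ℝ] ((Fin n → ℝ) →L[ℝ] ℂ) :=
  (ContinuousLinearMap.smulRightL ℝ (Fin n → ℝ) ℂ (ContinuousLinearMap.proj j)).comp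
    (ContinuousLinearMap.mul ℝ ℂ Complex.I)

theorem derivCoord_apply (j : Fin n) (z : ℂ) (v : Fin n → ℝ) :
    derivCoord j z v = v j • (Complex.I * z) := rfl

theorem norm_derivCoord_le (j : Fin n) : ‖derivCoord j‖ ≤ 1 := by
  refine ContinuousLinearMap.opNorm_le_bound _ zero_le_one fun z => ?_
  refine ContinuousLinearMap.opNorm_le_bound _ (by positivity) fun v => ?_
  rw [derivCoord_apply, norm_smul, norm_mul, Complex.norm_I, one_mul, mul_comm ‖z‖ ‖v‖]
  exact mul_le_mul_of_nonneg_right (norm_le_pi_norm v j) (norm_nonneg z)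

theorem fderiv_eq_sum (f : TorusSmooth n) :
    fderiv ℝ f = ∑ j, derivCoord j ∘ (D j f : (Fin n → ℝ) → ℂ) := by
  funext x
  ext v
  conv_lhs => rw [pi_eq_sum_univ' v]
  simp [fderiv_apply_single, derivCoord_apply]

theorem seminorm_succ_le (k : ℕ) (f : TorusSmooth n) :
    seminorm n (k + 1) f ≤ ∑ j, seminorm n k (D j f) := by
  refine seminorm_le_of_forall _ _ _ fun x => ?_
  have hc : ∀ j : Fin n, ContDiff ℝ k (derivCoord j ∘ (D j f : (Fin n → ℝ) → ℂ)) := fun j =>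
    (derivCoord j).contDiff.comp ((D j f).contDiff.of_le (by exact_mod_cast le_top))
  rw [← norm_iteratedFDeriv_fderiv, fderiv_eq_sum]
  have e := iteratedFDeriv_sum (𝕜 := ℝ) (u := Finset.univ) (i := k) fun j _ => hc j
  have e' : iteratedFDeriv ℝ k (∑ j, derivCoord j ∘ (D j f : (Fin n → ℝ) → ℂ)) x =
      ∑ j, iteratedFDeriv ℝ k (derivCoord j ∘ (D j f : (Fin n → ℝ) → ℂ)) x := by
    have h2 : (∑ j, derivCoord j ∘ (D j f : (Fin n → ℝ) → ℂ)) =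
      (fun y => ∑ j, (derivCoord j ∘ (D j f : (Fin n → ℝ) → ℂ)) y) := by
      funext y; simp
    rw [h2, e, Finset.sum_apply]
  rw [e']
  refine (norm_sum_le _ _).trans (Finset.sum_le_sum fun j _ => ?_)
  have h := (derivCoord j).norm_iteratedFDeriv_comp_left (f := (D j f : (Fin n → ℝ) → ℂ)) (x := x)
    (N := ∞) (n := k) (D j f).contDiff.contDiffAt (by exact_mod_cast le_top)
  exact h.trans ((mul_le_of_le_one_left (norm_nonneg _) (norm_derivCoord_le j)).trans
    (le_seminorm k _ x))

/-- If the first derivatives of `g` are multiples `β_j g`, where the `β_j` are of size `O(T)`, then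
the derivatives of `g` of order `k` are of size `O(T^k)`, uniformly in `g`. -/
theorem exists_seminorm_le_of_D_eq_mul (B : ℕ → ℝ) (k : ℕ) :
    ∃ C : ℝ, 0 ≤ C ∧ ∀ (g : TorusSmooth n) (β : Fin n → TorusSmooth n) (T : ℝ), 1 ≤ T →
      (∀ j, D j g = β j * g) → (∀ j i, seminorm n i (β j) ≤ B i * T) →
      seminorm n k g ≤ C * T ^ k * seminorm n 0 g := by
  induction k using Nat.strong_induction_on with
  | _ k ih =>
    rcases k with _ | k
    · exact ⟨1, zero_le_one, fun g β T _ _ _ => by simp⟩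
    · choose! C hC0 hC using ih
      refine ⟨∑ _j : Fin n, ∑ i ∈ Finset.range (k + 1), (k.choose i : ℝ) * |B i| * C (k - i),
        Finset.sum_nonneg fun _ _ => Finset.sum_nonneg fun i hi =>
          mul_nonneg (by positivity) (hC0 _ (by lia)), fun g β T hT hg hβ => ?_⟩
      refine (seminorm_succ_le k g).trans ?_
      rw [Finset.sum_mul, Finset.sum_mul]
      refine Finset.sum_le_sum fun j _ => ?_
      rw [hg j, Finset.sum_mul, Finset.sum_mul]
      refine (seminorm_mul_le k (β j) g).trans (Finset.sum_le_sum fun i hi => ?_)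
      have h1 : seminorm n i (β j) ≤ |B i| * T :=
        (hβ j i).trans (mul_le_mul_of_nonneg_right (le_abs_self _) (by linarith))
      have h2 : seminorm n (k - i) g ≤ C (k - i) * T ^ k * seminorm n 0 g := by
        refine (hC (k - i) (by lia) g β T hT hg hβ).trans ?_
        have := hC0 (k - i) (by lia)
        have h0 : 0 ≤ seminorm n 0 g := apply_nonneg _ _
        gcongr
        lia
      calc (k.choose i : ℝ) * seminorm n i (β j) * seminorm n (k - i) g
          ≤ (k.choose i : ℝ) * (|B i| * T) * (C (k - i) * T ^ k * seminorm n 0 g) := by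
            have h0 : 0 ≤ seminorm n (k - i) g := apply_nonneg _ _
            have : 0 ≤ |B i| * T := mul_nonneg (abs_nonneg _) (by linarith)
            gcongr
        _ = _ := by ring

/-- A function on the torus composed with the exponential. -/
def texp (f : TorusSmooth n) : TorusSmooth n :=
  mk (fun x => Complex.exp (f x)) (f.contDiff.cexp) (fun m x => by
    have := f.periodic m x
    simp only [this])

@[simp] theorem texp_apply (f : TorusSmooth n) (x : Fin n → ℝ) :
    texp f x = Complex.exp (f x) := rfl

theorem D_texp (j : Fin n) (f : TorusSmooth n) : D j (texp f) = D j f * texp f := by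
  ext x
  have hf : HasFDerivAt f (fderiv ℝ f x) x := (f.contDiff.differentiable (by simp) x).hasFDerivAt
  have e : fderiv ℝ (texp f) x = Complex.exp (f x) • fderiv ℝ f x := hf.cexp.fderiv
  simp only [D_apply, e, mul_apply, _root_.smul_apply, smul_eq_mul, texp_apply]
  ring

theorem texp_mul_texp_neg (f : TorusSmooth n) : texp f * texp (-f) = 1 := by
  ext x
  simp [← Complex.exp_add]

theorem fderiv_ofTime {N : ℕ} (a : TorusSmooth 1) (x v : Fin (N + 1) → ℝ) :
    fderiv ℝ (ofTime a : TorusSmooth (N + 1)) x v = fderiv ℝ a (fun _ => x 0) (fun _ => v 0) := by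
  let l : (Fin (N + 1) → ℝ) →L[ℝ] (Fin 1 → ℝ) :=
    ContinuousLinearMap.pi fun _ => ContinuousLinearMap.proj 0
  have ha : HasFDerivAt a (fderiv ℝ a (l x)) (l x) :=
    (a.contDiff.differentiable (by simp) _).hasFDerivAt
  have e : fderiv ℝ (ofTime a : TorusSmooth (N + 1)) x = _ := (ha.comp x l.hasFDerivAt).fderiv
  rw [e]
  rfl

theorem D_ofTime_zero {N : ℕ} (a : TorusSmooth 1) :
    D (0 : Fin (N + 1)) (ofTime a) = ofTime (D 0 a) := by
  ext x
  change _ = -Complex.I * fderiv ℝ a (fun _ => x 0) (Pi.single 0 1)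
  rw [D_apply, fderiv_ofTime]
  congr 2
  funext i
  simp [Subsingleton.elim i 0]

theorem D_ofTime_succ {N : ℕ} (j : Fin N) (a : TorusSmooth 1) :
    D j.succ (ofTime a : TorusSmooth (N + 1)) = 0 := by
  ext x
  have : (fun _ => (Pi.single j.succ (1 : ℝ) : Fin (N + 1) → ℝ) 0 : Fin 1 → ℝ) = 0 := by
    funext i
    simp [Fin.succ_ne_zero]
  rw [D_apply, fderiv_ofTime, this, map_zero, mul_zero, zero_apply]

/-- The integral of a derivative over the torus vanishes. -/
theorem integral_D (j : Fin n) (f : TorusSmooth n) :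
    ∫ x in Set.Icc (0 : Fin n → ℝ) (fun _ => 2 * Real.pi), D j f x = 0 := by
  obtain ⟨m, rfl⟩ : ∃ m, n = m + 1 := ⟨n - 1, by have := j.2; lia⟩
  have hdiff : Differentiable ℝ f := f.contDiff.differentiable (by simp)
  have hd : ContDiff ℝ ∞ (fun y => fderiv ℝ f y (Pi.single j 1)) :=
    (f.contDiff.fderiv_right (m := ∞) (by simp)).clm_apply contDiff_const
  have h := MeasureTheory.integral_divergence_of_hasFDerivAt_off_countable' (E := ℂ)
    (0 : Fin (m + 1) → ℝ) (fun _ => 2 * Real.pi) (fun _ => by simp [Real.pi_nonneg])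
    (fun i x => if i = j then f x else 0) (fun i x => if i = j then fderiv ℝ f x else 0) ∅
    Set.countable_empty
    (fun i => by
      by_cases hi : i = j
      · simpa [hi] using f.contDiff.continuous.continuousOn
      · simpa [hi] using continuousOn_const)
    (fun x _ i => by
      by_cases hi : i = j
      · simpa [hi] using (hdiff x).hasFDerivAt
      · simpa [hi] using hasFDerivAt_const (0 : ℂ) x)
    (by
      refine ContinuousOn.integrableOn_compact isCompact_Icc (Continuous.continuousOn ?_)
      refine continuous_finsetSum _ fun i _ => ?_
      by_cases hi : i = j
      · simpa [hi] using hd.continuous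
      · simpa [hi] using continuous_const)
  have hl : ∀ x, ∑ i, (if i = j then fderiv ℝ f x else 0) (Pi.single i 1) =
      fderiv ℝ f x (Pi.single j 1) := fun x => by
    rw [Finset.sum_eq_single j (fun i _ hi => by simp [hi]) (by simp)]
    simp
  simp only [hl] at h
  simp only [D_apply, MeasureTheory.integral_const_mul, h]
  rw [Finset.sum_eq_zero, mul_zero]
  intro i _
  by_cases hi : i = j
  · subst hi
    simp only [if_true, sub_eq_zero]
    congr 1
    funext x
    have := f.periodic (Pi.single i 1) (i.insertNth 0 x)
    rw [Pi.zero_apply, ← this]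
    congr 1
    funext l
    rcases eq_or_ne l i with rfl | hl
    · simp
    · obtain ⟨l, rfl⟩ := Fin.exists_succAbove_eq hl
      simp
  · simp [hi]

end TorusSmooth

/-! ### Summation over `ℤⁿ` -/

theorem summable_prod_inv_one_add_abs_sq (n : ℕ) :
    Summable fun η : Fin n → ℤ => ∏ j, ((1 + |(η j : ℝ)|) ^ 2)⁻¹ := by
  induction n with
  | zero => exact (hasSum_fintype _).summable
  | succ n ih =>
    have h1 : Summable fun k : ℤ => ((1 + |(k : ℝ)|) ^ 2)⁻¹ := by
      refine Summable.of_norm_bounded_eventually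
        ((Real.summable_one_div_int_pow (p := 2)).2 one_lt_two) ?_
      filter_upwards [(Set.finite_singleton (0 : ℤ)).compl_mem_cofinite] with k hk
      have hk0 : (k : ℝ) ≠ 0 := Int.cast_ne_zero.2 hk
      rw [Real.norm_of_nonneg (by positivity), one_div, ← sq_abs (k : ℝ)]
      have := abs_pos.2 hk0
      gcongr
      linarith
    have h2 := h1.mul_of_nonneg ih (fun k => by positivity)
      (fun η => Finset.prod_nonneg fun j _ => by positivity)
    rw [← (Fin.consEquiv fun _ : Fin (n + 1) => ℤ).summable_iff]
    refine h2.congr fun x => ?_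
    simp [Fin.consEquiv, Fin.prod_univ_succ, mul_comm]

theorem summable_inv_one_add_norm_pow (n : ℕ) :
    Summable fun η : Fin n → ℤ => ((1 + ‖η‖) ^ (2 * n))⁻¹ := by
  refine (summable_prod_inv_one_add_abs_sq n).of_nonneg_of_le (fun η => by positivity) fun η => ?_
  rw [Finset.prod_inv_distrib]
  refine inv_anti₀ (Finset.prod_pos fun j _ => by positivity) ?_
  calc ∏ j, (1 + |(η j : ℝ)|) ^ 2 ≤ ∏ _j : Fin n, (1 + ‖η‖) ^ 2 := by
        refine Finset.prod_le_prod (fun j _ => by positivity) fun j _ => ?_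
        have := norm_le_pi_norm η j
        rw [Int.norm_eq_abs] at this
        gcongr
    _ = (1 + ‖η‖) ^ (2 * n) := by simp [pow_mul]

/-- A family on `ℤⁿ` decays rapidly if it is `O((1 + ‖η‖)^{-K})` for every `K`. -/
def RapidDecay {n : ℕ} (a : (Fin n → ℤ) → ℂ) : Prop :=
  ∀ K : ℕ, ∃ C : ℝ, ∀ η, (1 + ‖η‖) ^ K * ‖a η‖ ≤ C

namespace RapidDecay

variable {n : ℕ} {a b : (Fin n → ℤ) → ℂ}

theorem summable (ha : RapidDecay a) (K : ℕ) : Summable fun η => (1 + ‖η‖) ^ K * ‖a η‖ := by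
  obtain ⟨C, hC⟩ := ha (K + 2 * n)
  refine ((summable_inv_one_add_norm_pow n).mul_left C).of_nonneg_of_le
    (fun η => by positivity) fun η => ?_
  rw [← div_eq_mul_inv, le_div_iff₀ (by positivity)]
  refine le_trans (le_of_eq ?_) (hC η)
  ring

theorem of_norm_le (hb : RapidDecay b) (C : ℝ) (M : ℕ)
    (h : ∀ η, ‖a η‖ ≤ C * (1 + ‖η‖) ^ M * ‖b η‖) : RapidDecay a := by
  intro K
  obtain ⟨B, hB⟩ := hb (K + M)
  refine ⟨|C| * B, fun η => ?_⟩
  calc (1 + ‖η‖) ^ K * ‖a η‖ ≤ (1 + ‖η‖) ^ K * (|C| * (1 + ‖η‖) ^ M * ‖b η‖) := by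
        have := h η
        have h2 := le_abs_self C
        gcongr
        refine this.trans ?_
        gcongr
    _ = |C| * ((1 + ‖η‖) ^ (K + M) * ‖b η‖) := by ring
    _ ≤ |C| * B := by gcongr; exact hB η

/-- The rapid decay is not affected by finitely many terms. -/
theorem of_norm_le_off_finite (hb : RapidDecay b) (C : ℝ) (M : ℕ) {s : Set (Fin n → ℤ)}
    (hs : s.Finite) (h : ∀ η ∉ s, ‖a η‖ ≤ C * (1 + ‖η‖) ^ M * ‖b η‖) : RapidDecay a := by
  classical
  have h1 : RapidDecay fun η => if η ∈ s then 0 else a η :=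
    hb.of_norm_le |C| M fun η => by
      have h2 := le_abs_self C
      by_cases hη : η ∈ s
      · simp only [hη, if_true, norm_zero]
        positivity
      · simp only [hη, if_false]
        refine (h η hη).trans ?_
        gcongr
  intro K
  obtain ⟨B, hB⟩ := h1 K
  refine ⟨max B (∑ η ∈ hs.toFinset, (1 + ‖η‖) ^ K * ‖a η‖), fun η => ?_⟩
  by_cases hη : η ∈ s
  · exact le_max_of_le_right (Finset.single_le_sum (f := fun η => (1 + ‖η‖) ^ K * ‖a η‖)
      (fun η _ => by positivity) (hs.mem_toFinset.2 hη))
  · have := hB η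
    simp only [hη, if_false] at this
    exact le_max_of_le_left this

end RapidDecay

namespace TorusSmooth

variable {n : ℕ}

/-! ### Convergence of series in `C^∞(𝕋ⁿ)` -/

/-- Taking the `k`-th derivative at `x`, as an additive map. -/
def iteratedFDerivHom (k : ℕ) (x : Fin n → ℝ) :
    TorusSmooth n →+ ContinuousMultilinearMap ℝ (fun _ : Fin k => Fin n → ℝ) ℂ :=
  AddMonoidHom.mk' (fun f => iteratedFDeriv ℝ k f x) fun f g =>
    iteratedFDeriv_add_apply (f.contDiff.of_le (by exact_mod_cast le_top)).contDiffAt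
      (g.contDiff.of_le (by exact_mod_cast le_top)).contDiffAt

/-- A series of smooth functions which is normally convergent for each seminorm converges in
`C^∞(𝕋ⁿ)`. -/
theorem exists_hasSum_of_summable_seminorm {ι : Type*} (h : ι → TorusSmooth n)
    (hs : ∀ k, Summable fun i => seminorm n k (h i)) : ∃ f, HasSum h f := by
  have hb : ∀ (k : ℕ) (i : ι) (x : Fin n → ℝ), ((k : ℕ∞) ≤ ((⊤ : ℕ∞))) →
      ‖iteratedFDeriv ℝ k (h i) x‖ ≤ seminorm n k (h i) := fun k i x _ => le_seminorm k (h i) x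
  have hc : ∀ i, ContDiff ℝ ∞ (h i) := fun i => (h i).contDiff
  have hsm : ContDiff ℝ ∞ fun x => ∑' i, h i x := contDiff_tsum hc (fun k _ => hs k) hb
  let f : TorusSmooth n := mk (fun x => ∑' i, h i x) hsm fun m x => by
    refine tsum_congr fun i => (h i).periodic m x
  refine ⟨f, ?_⟩
  rw [HasSum, (withSeminorms n).tendsto_nhds]
  intro k ε hε
  have hu := tendstoUniformly_tsum (f := fun i x => iteratedFDeriv ℝ k (h i) x) (hs k)
    (fun i x => le_seminorm k (h i) x)
  filter_upwards [Metric.tendstoUniformly_iff.1 hu (ε / 2) (half_pos hε)] with t ht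
  refine (seminorm_le_of_forall k _ (ε / 2) fun x => ?_).trans_lt (half_lt_self hε)
  have e1 : iteratedFDeriv ℝ k (∑ i ∈ t, h i - f : TorusSmooth n) x =
      ∑ i ∈ t, iteratedFDeriv ℝ k (h i) x - iteratedFDeriv ℝ k f x := by
    have := map_sub (iteratedFDerivHom k x) (∑ i ∈ t, h i) f
    rw [map_sum] at this
    exact this
  have e2 : iteratedFDeriv ℝ k f x = ∑' i, iteratedFDeriv ℝ k (h i) x :=
    iteratedFDeriv_tsum_apply hc (fun k _ => hs k) hb le_top x
  rw [e1, e2, ← dist_eq_norm, dist_comm]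
  exact (ht x).le

/-! ### Characters -/

/-- The character `x ↦ e^{i η·x}` of the torus. -/
def character (η : Fin n → ℤ) : TorusSmooth n :=
  mk (fun x => Complex.exp (Complex.I * ∑ j, (η j : ℂ) * (x j : ℂ)))
    (by
      refine ContDiff.cexp (contDiff_const.mul (ContDiff.sum fun j _ => contDiff_const.mul ?_))
      exact Complex.ofRealCLM.contDiff.comp (contDiff_apply ℝ ℝ j))
    (fun m x => by
      rw [Complex.exp_eq_exp_iff_exists_int]
      refine ⟨∑ j, η j * m j, ?_⟩
      push_cast [Pi.add_apply]
      simp only [mul_add, Finset.sum_add_distrib, Finset.mul_sum, Finset.sum_mul]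
      congr 1
      refine Finset.sum_congr rfl fun j _ => ?_
      ring)

theorem character_apply (η : Fin n → ℤ) (x : Fin n → ℝ) :
    character η x = Complex.exp (Complex.I * ∑ j, (η j : ℂ) * (x j : ℂ)) := rfl

theorem character_zero : character (0 : Fin n → ℤ) = 1 := by
  ext x
  simp [character_apply]

theorem norm_character_apply (η : Fin n → ℤ) (x : Fin n → ℝ) : ‖character η x‖ = 1 := by
  have : ∑ j, (η j : ℂ) * (x j : ℂ) = ((∑ j, (η j : ℝ) * x j : ℝ) : ℂ) := by push_cast; rfl
  rw [character_apply, this, mul_comm, Complex.norm_exp_ofReal_mul_I]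

theorem seminorm_zero_character_le (η : Fin n → ℤ) : seminorm n 0 (character η) ≤ 1 :=
  seminorm_le_of_forall _ _ _ fun x => by
    rw [norm_iteratedFDeriv_zero, norm_character_apply]

theorem D_character (j : Fin n) (η : Fin n → ℤ) :
    D j (character η) = (η j : ℂ) • character η := by
  ext x
  have h1 : HasFDerivAt (fun y : Fin n → ℝ => Complex.I * ∑ l, (η l : ℂ) * (y l : ℂ))
      (Complex.I • ∑ l, (η l : ℂ) • (Complex.ofRealCLM.comp
        (ContinuousLinearMap.proj l : (Fin n → ℝ) →L[ℝ] ℝ))) x := by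
    refine HasFDerivAt.const_mul (HasFDerivAt.fun_sum fun l _ => HasFDerivAt.const_mul ?_ _) _
    exact (Complex.ofRealCLM.comp
      (ContinuousLinearMap.proj l : (Fin n → ℝ) →L[ℝ] ℝ)).hasFDerivAt
  have e : fderiv ℝ (character η) x = _ := h1.cexp.fderiv
  have e2 : ∑ l, (η l : ℂ) * ((Pi.single j (1 : ℝ) : Fin n → ℝ) l : ℂ) = η j := by
    rw [Finset.sum_eq_single j (fun l _ hl => by simp [hl]) (by simp)]
    simp
  rw [D_apply, e]
  simp only [_root_.smul_apply, smul_eq_mul, _root_.sum_apply,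
    ContinuousLinearMap.comp_apply, Complex.ofRealCLM_apply, ContinuousLinearMap.proj_apply, e2,
    smul_apply, character_apply]
  linear_combination (-(η j : ℂ) * Complex.exp (Complex.I * ∑ l, (η l : ℂ) * (x l : ℂ))) *
    Complex.I_mul_I

theorem exists_seminorm_character_le (n k : ℕ) :
    ∃ C : ℝ, 0 ≤ C ∧ ∀ η : Fin n → ℤ, seminorm n k (character η) ≤ C * (1 + ‖η‖) ^ k := by
  obtain ⟨C, hC0, hC⟩ := exists_seminorm_le_of_D_eq_mul (n := n) (fun i => seminorm n i 1) k
  refine ⟨C, hC0, fun η => ?_⟩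
  have h := hC (character η) (fun j => (η j : ℂ) • 1) (1 + ‖η‖) (by linarith [norm_nonneg η])
    (fun j => by rw [D_character, smul_mul_assoc, one_mul]) (fun j i => by
      have h1 := norm_le_pi_norm η j
      rw [map_smul_eq_mul, mul_comm]
      refine mul_le_mul_of_nonneg_left ?_ (apply_nonneg _ _)
      rw [Complex.norm_intCast, ← Int.norm_eq_abs]
      linarith)
  refine h.trans (mul_le_of_le_one_right (by positivity) (seminorm_zero_character_le η))

/-- The Fourier series of a rapidly decaying family converges in `C^∞(𝕋ⁿ)`. -/
theorem exists_hasSum_smul_character {a : (Fin n → ℤ) → ℂ} (ha : RapidDecay a) :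
    ∃ f : TorusSmooth n, HasSum (fun η => a η • character η) f := by
  refine exists_hasSum_of_summable_seminorm _ fun k => ?_
  obtain ⟨C, hC0, hC⟩ := exists_seminorm_character_le n k
  refine ((ha.summable k).mul_left C).of_nonneg_of_le (fun η => apply_nonneg _ _) fun η => ?_
  rw [map_smul_eq_mul]
  calc ‖a η‖ * seminorm n k (character η) ≤ ‖a η‖ * (C * (1 + ‖η‖) ^ k) := by gcongr; exact hC η
    _ = _ := by ring

end TorusSmooth

namespace TorusDistribution

variable {n : ℕ}

/-! ### Smooth functions as distributions -/

theorem ofSmooth_apply (f φ : TorusSmooth n) :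
    ofSmooth f φ = ∫ x in Set.Icc (0 : Fin n → ℝ) (fun _ => 2 * Real.pi), f x * φ x := rfl

theorem ofSmooth_comm (f φ : TorusSmooth n) : ofSmooth f φ = ofSmooth φ f := by
  simp only [ofSmooth_apply, mul_comm]

theorem ofSmooth_mul (a f φ : TorusSmooth n) : ofSmooth (a * f) φ = ofSmooth f (a * φ) := by
  simp only [ofSmooth_apply, TorusSmooth.mul_apply]
  refine MeasureTheory.integral_congr_ae (Filter.Eventually.of_forall fun x => ?_)
  simp only
  ring

theorem ofSmooth_one_right (f : TorusSmooth n) :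
    ofSmooth f 1 = ∫ x in Set.Icc (0 : Fin n → ℝ) (fun _ => 2 * Real.pi), f x := by
  simp [ofSmooth_apply]

@[simp] theorem D_apply (j : Fin n) (u : TorusDistribution n) (φ : TorusSmooth n) :
    D j u φ = -u (TorusSmooth.D j φ) := rfl

@[simp] theorem mul_apply (a : TorusSmooth n) (u : TorusDistribution n) (φ : TorusSmooth n) :
    mul a u φ = u (a * φ) := rfl

theorem mul_ofSmooth (a f : TorusSmooth n) : mul a (ofSmooth f) = ofSmooth (a * f) := by
  ext φ
  rw [mul_apply, ofSmooth_mul]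

theorem ofSmooth_D_apply (j : Fin n) (f φ : TorusSmooth n) :
    ofSmooth (TorusSmooth.D j f) φ = -ofSmooth f (TorusSmooth.D j φ) := by
  have h := TorusSmooth.integral_D j (f * φ)
  have e : ofSmooth 1 (TorusSmooth.D j (f * φ)) = 0 := by
    rw [ofSmooth_comm, ofSmooth_one_right, h]
  rw [TorusSmooth.D_mul, map_add, ← ofSmooth_mul, ← ofSmooth_mul, mul_one, mul_one] at e
  exact eq_neg_of_add_eq_zero_left e

theorem D_ofSmooth (j : Fin n) (f : TorusSmooth n) :
    D j (ofSmooth f) = ofSmooth (TorusSmooth.D j f) := by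
  ext φ
  rw [D_apply, ofSmooth_D_apply]

theorem D_mul (j : Fin n) (a : TorusSmooth n) (u : TorusDistribution n) :
    D j (mul a u) = mul (TorusSmooth.D j a) u + mul a (D j u) := by
  ext φ
  simp only [D_apply, mul_apply, add_apply, TorusSmooth.D_mul, map_add]
  ring

theorem norm_ofSmooth_le (f φ : TorusSmooth n) :
    ‖ofSmooth f φ‖ ≤ (2 * Real.pi) ^ n * TorusSmooth.seminorm n 0 f *
      TorusSmooth.seminorm n 0 φ := by
  have h := MeasureTheory.norm_setIntegral_le_of_norm_le_const (μ := MeasureTheory.volume)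
    (s := Set.Icc (0 : Fin n → ℝ) (fun _ => 2 * Real.pi)) (f := fun x => f x * φ x)
    (C := TorusSmooth.seminorm n 0 f * TorusSmooth.seminorm n 0 φ)
    isCompact_Icc.measure_lt_top (fun x _ => by
      rw [norm_mul]
      exact mul_le_mul (f.norm_apply_le x) (φ.norm_apply_le x) (norm_nonneg _)
        (apply_nonneg _ _))
  have hv : MeasureTheory.volume.real (Set.Icc (0 : Fin n → ℝ) (fun _ => 2 * Real.pi)) =
      (2 * Real.pi) ^ n := by
    rw [MeasureTheory.measureReal_def, Real.volume_Icc_pi_toReal]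
    · simp
    · exact fun _ => by simp [Real.pi_nonneg]
  rw [hv] at h
  rw [ofSmooth_apply]
  refine h.trans (le_of_eq ?_)
  ring

/-- Integration by parts: the pairing of `φ` with a function of frequency `z` in the variable `x_j`
is `O(|z|^{-K})`. -/
theorem norm_pow_mul_ofSmooth_le {j : Fin n} {g : TorusSmooth n} {z : ℂ}
    (hg : TorusSmooth.D j g = z • g) (K : ℕ) (φ : TorusSmooth n) :
    ‖z‖ ^ K * ‖ofSmooth g φ‖ ≤
      (2 * Real.pi) ^ n * TorusSmooth.seminorm n 0 g * TorusSmooth.seminorm n K φ := by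
  have key : ∀ K : ℕ, ∀ φ : TorusSmooth n, ‖z‖ ^ K * ‖ofSmooth g φ‖ =
      ‖ofSmooth g ((TorusSmooth.D j)^[K] φ)‖ := by
    intro K
    induction K with
    | zero => intro φ; simp
    | succ K ih =>
      intro φ
      have h := ofSmooth_D_apply j g φ
      rw [hg, ofSmooth_comm, map_smul, ofSmooth_comm, smul_eq_mul] at h
      rw [pow_succ, mul_assoc, ← norm_mul, h, norm_neg, ih, Function.iterate_succ_apply]
  have hk : ∀ K i : ℕ, ∀ φ : TorusSmooth n, TorusSmooth.seminorm n i ((TorusSmooth.D j)^[K] φ) ≤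
      TorusSmooth.seminorm n (i + K) φ := by
    intro K
    induction K with
    | zero => intro i φ; simp
    | succ K ih =>
      intro i φ
      rw [Function.iterate_succ_apply]
      exact (ih i _).trans (TorusSmooth.seminorm_Dlin_le j (i + K) φ)
  rw [key]
  refine (norm_ofSmooth_le _ _).trans ?_
  have h0 : 0 ≤ TorusSmooth.seminorm n 0 g := apply_nonneg _ _
  have := hk K 0 φ
  rw [zero_add] at this
  gcongr

/-- Decay of the pairing with a function of frequency `ξ` in some of the variables. -/
theorem one_add_norm_pow_mul_ofSmooth_le {d : ℕ} {e : Fin d → Fin n} {ξ : Fin d → ℤ}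
    {g : TorusSmooth n} (hg : ∀ j, TorusSmooth.D (e j) g = (ξ j : ℂ) • g) (K : ℕ)
    (φ : TorusSmooth n) :
    (1 + ‖ξ‖) ^ K * ‖ofSmooth g φ‖ ≤ 2 ^ K * (2 * Real.pi) ^ n * TorusSmooth.seminorm n 0 g *
      (TorusSmooth.seminorm n 0 φ + TorusSmooth.seminorm n K φ) := by
  have h0 : 0 ≤ TorusSmooth.seminorm n 0 g := apply_nonneg _ _
  have h1 : 0 ≤ TorusSmooth.seminorm n 0 φ := apply_nonneg _ _
  have h2 : 0 ≤ TorusSmooth.seminorm n K φ := apply_nonneg _ _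
  have h3 : (0 : ℝ) ≤ (2 * Real.pi) ^ n := by positivity
  rcases le_or_gt ‖ξ‖ 1 with h | h
  · calc (1 + ‖ξ‖) ^ K * ‖ofSmooth g φ‖
        ≤ 2 ^ K * ((2 * Real.pi) ^ n * TorusSmooth.seminorm n 0 g *
          (TorusSmooth.seminorm n 0 φ + TorusSmooth.seminorm n K φ)) := by
          gcongr
          · linarith
          · refine (norm_ofSmooth_le g φ).trans ?_
            gcongr
            linarith
      _ = _ := by ring
  · obtain ⟨j, hj⟩ : ∃ j, ‖ξ‖ = ‖ξ j‖ := by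
      have hne : Nonempty (Fin d) := by
        by_contra hd
        rw [not_nonempty_iff] at hd
        rw [Subsingleton.elim ξ 0, norm_zero] at h
        linarith
      obtain ⟨j, -, hj⟩ := Finset.exists_mem_eq_sup' (s := Finset.univ)
        (Finset.univ_nonempty (α := Fin d)) (fun j => ‖ξ j‖)
      refine ⟨j, le_antisymm ?_ (norm_le_pi_norm ξ j)⟩
      refine (pi_norm_le_iff_of_nonneg (norm_nonneg _)).2 fun i => ?_
      rw [← hj]
      exact Finset.le_sup' (f := fun j => ‖ξ j‖) (Finset.mem_univ i)
    have hz : ‖(ξ j : ℂ)‖ = ‖ξ‖ := by rw [hj, Complex.norm_intCast, Int.norm_eq_abs]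
    have h4 := norm_pow_mul_ofSmooth_le (hg j) K φ
    rw [hz] at h4
    calc (1 + ‖ξ‖) ^ K * ‖ofSmooth g φ‖ ≤ (2 * ‖ξ‖) ^ K * ‖ofSmooth g φ‖ := by
          gcongr
          linarith
      _ = 2 ^ K * (‖ξ‖ ^ K * ‖ofSmooth g φ‖) := by ring
      _ ≤ 2 ^ K * ((2 * Real.pi) ^ n * TorusSmooth.seminorm n 0 g *
          (TorusSmooth.seminorm n 0 φ + TorusSmooth.seminorm n K φ)) := by
          refine mul_le_mul_of_nonneg_left (h4.trans ?_) (by positivity)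
          gcongr
          linarith
      _ = _ := by ring

/-! ### Fourier coefficients -/

/-- The Fourier coefficient `(2π)⁻ⁿ ⟨u, e^{-i η·x}⟩`. -/
def coeff (u : TorusDistribution n) (η : Fin n → ℤ) : ℂ :=
  (((2 * Real.pi) ^ n : ℝ) : ℂ)⁻¹ * u (TorusSmooth.character (-η))

theorem coeff_add (u v : TorusDistribution n) (η : Fin n → ℤ) :
    coeff (u + v) η = coeff u η + coeff v η := by simp [coeff, mul_add]

theorem coeff_sub (u v : TorusDistribution n) (η : Fin n → ℤ) :
    coeff (u - v) η = coeff u η - coeff v η := by simp [coeff, mul_sub]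

theorem coeff_sum {ι : Type*} (s : Finset ι) (u : ι → TorusDistribution n) (η : Fin n → ℤ) :
    coeff (∑ i ∈ s, u i) η = ∑ i ∈ s, coeff (u i) η := by
  simp [coeff, Finset.mul_sum]

theorem coeff_D (j : Fin n) (u : TorusDistribution n) (η : Fin n → ℤ) :
    coeff (D j u) η = η j * coeff u η := by
  simp only [coeff, D_apply, TorusSmooth.D_character, map_smul, smul_eq_mul, Pi.neg_apply,
    Int.cast_neg]
  ring

theorem coeff_mul_algebraMap (z : ℂ) (u : TorusDistribution n) (η : Fin n → ℤ) :
    coeff (mul (algebraMap ℂ (TorusSmooth n) z) u) η = z * coeff u η := by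
  simp only [coeff, mul_apply, ← Algebra.smul_def, map_smul, smul_eq_mul]
  ring

theorem coeff_ofSmooth (f : TorusSmooth n) (η : Fin n → ℤ) :
    coeff (ofSmooth f) η = (((2 * Real.pi) ^ n : ℝ) : ℂ)⁻¹ *
      ofSmooth (TorusSmooth.character (-η)) f := by
  rw [coeff, ofSmooth_comm]

end TorusDistribution

namespace TorusSmooth

variable {n : ℕ}

open TorusDistribution (ofSmooth)

/-- The Fourier coefficients of a smooth function, as continuous linear functionals. -/
def coeff (η : Fin n → ℤ) : TorusSmooth n →L[ℂ] ℂ :=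
  (((2 * Real.pi) ^ n : ℝ) : ℂ)⁻¹ • ofSmooth (character (-η))

theorem coeff_apply (η : Fin n → ℤ) (f : TorusSmooth n) :
    coeff η f = (((2 * Real.pi) ^ n : ℝ) : ℂ)⁻¹ * ofSmooth (character (-η)) f := rfl

theorem coeff_ofSmooth (η : Fin n → ℤ) (f : TorusSmooth n) :
    TorusDistribution.coeff (ofSmooth f) η = coeff η f := by
  rw [TorusDistribution.coeff_ofSmooth, coeff_apply]

theorem mean_eq_coeff (f : TorusSmooth n) : mean f = coeff 0 f := by
  rw [coeff_apply, neg_zero, character_zero, TorusDistribution.ofSmooth_comm,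
    TorusDistribution.ofSmooth_one_right, mean]

theorem coeff_D (j : Fin n) (f : TorusSmooth n) (η : Fin n → ℤ) :
    coeff η (D j f) = η j * coeff η f := by
  rw [← coeff_ofSmooth, ← TorusDistribution.D_ofSmooth, TorusDistribution.coeff_D, coeff_ofSmooth]

theorem mean_algebraMap (z : ℂ) : mean (algebraMap ℂ (TorusSmooth n) z) = z := by
  have h : (2 * (Real.pi : ℂ)) ^ n ≠ 0 := by
    simp [Real.pi_ne_zero]
  have hv : MeasureTheory.volume.real (Set.Icc (0 : Fin n → ℝ) (fun _ => 2 * Real.pi)) =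
      (2 * Real.pi) ^ n := by
    rw [MeasureTheory.measureReal_def, Real.volume_Icc_pi_toReal]
    · simp
    · exact fun _ => by simp [Real.pi_nonneg]
  simp only [mean, algebraMap_apply, MeasureTheory.setIntegral_const, hv, Complex.real_smul]
  push_cast
  field_simp

theorem coeff_character [DecidableEq (Fin n → ℤ)] (η η' : Fin n → ℤ) :
    coeff η (character η') = if η = η' then 1 else 0 := by
  split_ifs with h
  · subst h
    have e : character (-η) * character η = 1 := by
      ext x
      simp [character_apply, ← Complex.exp_add]
    have h1 := mean_algebraMap (n := n) 1
    rw [mean_eq_coeff, map_one, coeff_apply, neg_zero, character_zero] at h1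
    have h2 := TorusDistribution.ofSmooth_mul (character (-η)) 1 (character η)
    rw [mul_one, e] at h2
    rw [coeff_apply, h2, h1]
  · obtain ⟨j, hj⟩ := Function.ne_iff.1 h
    have h1 := coeff_D j (character η') η
    rw [D_character, map_smul, smul_eq_mul] at h1
    have h2 : ((η' j : ℂ) - η j) * coeff η (character η') = 0 := by rw [sub_mul, h1, sub_self]
    refine (mul_eq_zero.1 h2).resolve_left (sub_ne_zero.2 ?_)
    exact_mod_cast Ne.symm hj

theorem one_add_norm_pow_mul_coeff_le (K : ℕ) (f : TorusSmooth n) (η : Fin n → ℤ) :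
    (1 + ‖η‖) ^ K * ‖coeff η f‖ ≤ 2 ^ K * (seminorm n 0 f + seminorm n K f) := by
  have hpi : (0 : ℝ) < (2 * Real.pi) ^ n := by positivity
  have h := TorusDistribution.one_add_norm_pow_mul_ofSmooth_le (e := id) (ξ := -η)
    (g := character (-η)) (fun j => D_character j (-η)) K f
  have h1 := seminorm_zero_character_le (-η)
  have h0 : 0 ≤ seminorm n 0 f := apply_nonneg _ _
  have h2 : 0 ≤ seminorm n K f := apply_nonneg _ _
  rw [norm_neg] at h
  rw [coeff_apply, norm_mul, norm_inv, Complex.norm_real, Real.norm_of_nonneg hpi.le,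
    mul_left_comm, inv_mul_le_iff₀ hpi]
  refine h.trans ?_
  calc 2 ^ K * (2 * Real.pi) ^ n * seminorm n 0 (character (-η)) * (seminorm n 0 f + seminorm n K f)
      ≤ 2 ^ K * (2 * Real.pi) ^ n * 1 * (seminorm n 0 f + seminorm n K f) := by gcongr
    _ = _ := by ring

/-- The Fourier coefficients of a smooth function decay rapidly. -/
theorem rapidDecay_coeff (f : TorusSmooth n) : RapidDecay fun η => coeff η f :=
  fun K => ⟨_, one_add_norm_pow_mul_coeff_le K f⟩

/-! ### Fourier inversion -/

/-- A smooth function on the torus, as a continuous function on `(ℝ / ℤ)ⁿ`. -/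
theorem exists_continuousMap (f : TorusSmooth n) : ∃ F : C(UnitAddTorus (Fin n), ℂ),
    ∀ x : Fin n → ℝ, F (fun i => (x i : UnitAddCircle)) = f (fun i => 2 * Real.pi * x i) := by
  have hq : IsOpenQuotientMap (Pi.map fun _ : Fin n => ((↑) : ℝ → UnitAddCircle)) :=
    IsOpenQuotientMap.piMap fun _ => QuotientAddGroup.isOpenQuotientMap_mk
  let r : UnitAddTorus (Fin n) → (Fin n → ℝ) := fun y i => Quotient.out (y i)
  have hr : ∀ x : Fin n → ℝ, f (fun i => 2 * Real.pi * r (fun i => (x i : UnitAddCircle)) i) =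
      f (fun i => 2 * Real.pi * x i) := by
    intro x
    have h1 : ∀ i, ∃ m : ℤ, r (fun i => (x i : UnitAddCircle)) i = x i + m := by
      intro i
      have h2 : ((r (fun i => (x i : UnitAddCircle)) i : ℝ) : UnitAddCircle) = x i :=
        Quotient.out_eq' _
      rw [← sub_eq_zero, ← AddCircle.coe_sub, AddCircle.coe_eq_zero_iff] at h2
      obtain ⟨m, hm⟩ := h2
      exact ⟨m, by rw [zsmul_eq_mul, mul_one] at hm; linarith⟩
    choose m hm using h1
    rw [← f.periodic m (fun i => 2 * Real.pi * x i)]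
    congr 1
    funext i
    rw [hm, Pi.add_apply]
    ring
  refine ⟨⟨fun y => f (fun i => 2 * Real.pi * r y i), ?_⟩, hr⟩
  rw [hq.isQuotientMap.continuous_iff]
  have : (fun y => f (fun i => 2 * Real.pi * r y i)) ∘
      (Pi.map fun _ : Fin n => ((↑) : ℝ → UnitAddCircle)) =
      fun x => f (fun i => 2 * Real.pi * x i) :=
    funext hr
  rw [this]
  exact f.contDiff.continuous.comp (by fun_prop)

theorem mFourier_coe (η : Fin n → ℤ) (x : Fin n → ℝ) :
    UnitAddTorus.mFourier η (fun i => (x i : UnitAddCircle)) =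
      character η (fun i => 2 * Real.pi * x i) := by
  simp only [UnitAddTorus.mFourier, ContinuousMap.coe_mk, fourier_coe_apply, character_apply,
    ← Complex.exp_sum, Finset.mul_sum]
  congr 1
  refine Finset.sum_congr rfl fun j _ => ?_
  push_cast
  ring

open scoped Pointwise in
theorem mFourierCoeff_eq_coeff (f : TorusSmooth n) (F : C(UnitAddTorus (Fin n), ℂ))
    (hF : ∀ x : Fin n → ℝ, F (fun i => (x i : UnitAddCircle)) = f (fun i => 2 * Real.pi * x i))
    (η : Fin n → ℤ) : UnitAddTorus.mFourierCoeff F η = coeff η f := by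
  have hpi : (0 : ℝ) < 2 * Real.pi := by positivity
  rw [UnitAddTorus.mFourierCoeff_eq_integral F η 0]
  simp only [mFourier_coe, hF, smul_eq_mul]
  have hs : {x : Fin n → ℝ | ∀ i, x i ∈ Set.Ioc ((0 : Fin n → ℝ) i) ((0 : Fin n → ℝ) i + 1)} =
      Set.pi Set.univ fun i => Set.Ioc ((0 : Fin n → ℝ) i) ((1 : Fin n → ℝ) i) := by
    ext x
    simp [Set.mem_pi]
  rw [hs, MeasureTheory.volume_pi,
    MeasureTheory.setIntegral_congr_set MeasureTheory.Measure.univ_pi_Ioc_ae_eq_Icc]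
  have h := MeasureTheory.Measure.setIntegral_comp_smul_of_pos MeasureTheory.volume
    (fun x => character (-η) x * f x) (Set.Icc (0 : Fin n → ℝ) 1) hpi
  have hI : (2 * Real.pi) • Set.Icc (0 : Fin n → ℝ) 1 = Set.Icc 0 fun _ => 2 * Real.pi := by
    ext x
    rw [Set.mem_smul_set_iff_inv_smul_mem₀ hpi.ne']
    simp only [Set.mem_Icc, Pi.le_def, Pi.zero_apply, Pi.smul_apply, smul_eq_mul, Pi.one_apply,
      inv_mul_le_iff₀ hpi, mul_one, mul_nonneg_iff_of_pos_left (inv_pos.2 hpi)]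
  rw [hI, Module.finrank_fin_fun, Complex.real_smul] at h
  rw [← MeasureTheory.volume_pi, coeff_apply, TorusDistribution.ofSmooth_apply,
    ← Complex.ofReal_inv, ← h]
  rfl

/-- A smooth function is determined by its Fourier coefficients. -/
theorem ext_coeff {f g : TorusSmooth n} (h : ∀ η, coeff η f = coeff η g) : f = g := by
  have hfg : ∀ η, coeff η (f - g) = 0 := fun η => by rw [map_sub, h, sub_self]
  obtain ⟨F, hF⟩ := exists_continuousMap (f - g)
  have hc : UnitAddTorus.mFourierCoeff F = fun _ => 0 :=
    funext fun η => (mFourierCoeff_eq_coeff _ F hF η).trans (hfg η)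
  rw [← sub_eq_zero]
  ext x
  have hs := UnitAddTorus.hasSum_mFourier_series_apply_of_summable (f := F)
    (by rw [hc]; exact summable_zero) (fun i => ((x i / (2 * Real.pi) : ℝ) : UnitAddCircle))
  simp only [hc, zero_smul] at hs
  have h0 := hs.unique hasSum_zero
  rw [hF] at h0
  rw [zero_apply, ← h0]
  congr 1
  funext i
  field_simp

theorem coeff_of_hasSum {a : (Fin n → ℤ) → ℂ} {f : TorusSmooth n}
    (h : HasSum (fun η => a η • character η) f) (η : Fin n → ℤ) : coeff η f = a η := by
  classical
  have h1 := (coeff η).hasSum h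
  have h2 : HasSum (fun η' => coeff η (a η' • character η')) (a η) := by
    convert hasSum_single η fun η' hη' => ?_ using 1
    · simp [coeff_character]
    · simp [coeff_character, hη'.symm]
  exact h1.unique h2

theorem exists_coeff_eq {a : (Fin n → ℤ) → ℂ} (ha : RapidDecay a) :
    ∃ f : TorusSmooth n, ∀ η, coeff η f = a η := by
  obtain ⟨f, hf⟩ := exists_hasSum_smul_character ha
  exact ⟨f, coeff_of_hasSum hf⟩

/-- The Fourier series of a smooth function converges to it in `C^∞(𝕋ⁿ)`. -/
theorem hasSum_coeff_smul_character (f : TorusSmooth n) :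
    HasSum (fun η => coeff η f • character η) f := by
  obtain ⟨g, hg⟩ := exists_hasSum_smul_character f.rapidDecay_coeff
  rwa [ext_coeff fun η => coeff_of_hasSum hg η] at hg

theorem seminorm_zero_le_tsum_coeff (f : TorusSmooth n) :
    seminorm n 0 f ≤ ∑' η, ‖coeff η f‖ := by
  have hs : Summable fun η => ‖coeff η f‖ := by simpa using f.rapidDecay_coeff.summable 0
  have ht := (((withSeminorms n).continuous_seminorm 0).tendsto f).comp
    f.hasSum_coeff_smul_character
  refine le_of_tendsto' ht fun s => ?_
  calc seminorm n 0 (∑ η ∈ s, coeff η f • character η)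
      ≤ ∑ η ∈ s, seminorm n 0 (coeff η f • character η) :=
        Finset.le_sum_of_subadditive _ (map_zero _).le (map_add_le_add _) s _
    _ ≤ ∑ η ∈ s, ‖coeff η f‖ := Finset.sum_le_sum fun η _ => by
        rw [map_smul_eq_mul]
        exact mul_le_of_le_one_right (norm_nonneg _) (seminorm_zero_character_le η)
    _ ≤ ∑' η, ‖coeff η f‖ := hs.sum_le_tsum s fun _ _ => norm_nonneg _

end TorusSmooth

namespace TorusDistribution

variable {n : ℕ}

/-- A distribution with rapidly decaying Fourier coefficients is smooth. -/
theorem mem_range_ofSmooth_of_rapidDecay {u : TorusDistribution n} (hu : RapidDecay (coeff u)) :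
    u ∈ Set.range ofSmooth := by
  obtain ⟨f, hf⟩ := TorusSmooth.exists_coeff_eq hu
  refine ⟨f, ?_⟩
  have hc : ∀ η, ofSmooth f (TorusSmooth.character η) = u (TorusSmooth.character η) := by
    intro η
    have h := hf (-η)
    rw [← TorusSmooth.coeff_ofSmooth, coeff, coeff, neg_neg] at h
    have hpi : (((2 * Real.pi) ^ n : ℝ) : ℂ)⁻¹ ≠ 0 := by
      have := Real.pi_pos
      exact inv_ne_zero (Complex.ofReal_ne_zero.2 (by positivity))
    exact mul_left_cancel₀ hpi h
  ext φ
  have h1 := (ofSmooth f).hasSum (TorusSmooth.hasSum_coeff_smul_character φ)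
  have h2 := u.hasSum (TorusSmooth.hasSum_coeff_smul_character φ)
  simp only [map_smul, hc] at h1 h2
  exact h1.unique h2

end TorusDistribution

namespace TorusSmooth

/-! ### Fourier multipliers -/

/-- A Fourier multiplier with a bounded symbol. -/
theorem exists_coeff_eq_mul {n : ℕ} (w : (Fin n → ℤ) → ℂ) (C : ℝ) (hw : ∀ η, ‖w η‖ ≤ C)
    (f : TorusSmooth n) : ∃ g : TorusSmooth n, ∀ η, coeff η g = w η * coeff η f :=
  exists_coeff_eq (f.rapidDecay_coeff.of_norm_le C 0 fun η => by
    rw [norm_mul, pow_zero, mul_one]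
    exact mul_le_mul_of_nonneg_right (hw η) (norm_nonneg _))

/-- A function of mean zero on the circle has a primitive. -/
theorem exists_D_eq_of_mean_eq_zero (f : TorusSmooth 1) (hf : mean f = 0) :
    ∃ b : TorusSmooth 1, D 0 b = f := by
  obtain ⟨b, hb⟩ := exists_coeff_eq_mul (fun η => (η 0 : ℂ)⁻¹) 1 (fun η => by
    rcases eq_or_ne (η 0) 0 with h | h
    · simp [h]
    · rw [norm_inv, Complex.norm_intCast]
      exact inv_le_one_of_one_le₀ (by exact_mod_cast Int.one_le_abs h)) f
  refine ⟨b, ext_coeff fun η => ?_⟩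
  rw [coeff_D, hb]
  rcases eq_or_ne (η 0) 0 with h | h
  · have : η = 0 := funext fun i => by rw [Subsingleton.elim i 0, h, Pi.zero_apply]
    rw [this, ← mean_eq_coeff, hf, mul_zero, mul_zero]
  · rw [← mul_assoc, mul_inv_cancel₀ (by exact_mod_cast h), one_mul]

variable {N : ℕ}

/-! ### Functions with a single spatial frequency -/

/-- `g(t,x) = u(t) e^{i ξ·x}` for some `u`, expressed by the equations `D_{x_j} g = ξ_j g`. -/
def HasSpatialFreq (g : TorusSmooth (N + 1)) (ξ : Fin N → ℤ) : Prop :=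
  ∀ j : Fin N, D j.succ g = (ξ j : ℂ) • g

theorem HasSpatialFreq.smul {g : TorusSmooth (N + 1)} {ξ : Fin N → ℤ} (hg : HasSpatialFreq g ξ)
    (z : ℂ) : HasSpatialFreq (z • g) ξ := fun j => by rw [map_smul, hg j, smul_comm]

theorem HasSpatialFreq.mul {a g : TorusSmooth (N + 1)} {ξ : Fin N → ℤ}
    (ha : ∀ j : Fin N, D j.succ a = 0) (hg : HasSpatialFreq g ξ) : HasSpatialFreq (a * g) ξ :=
  fun j => by rw [D_mul, ha j, hg j, zero_mul, zero_add, mul_smul_comm]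

theorem hasSpatialFreq_character (η : Fin (N + 1) → ℤ) :
    HasSpatialFreq (character η) (Fin.tail η) := fun j => D_character j.succ η

theorem HasSpatialFreq.coeff_eq_zero {g : TorusSmooth (N + 1)} {ξ : Fin N → ℤ}
    (hg : HasSpatialFreq g ξ) {η : Fin (N + 1) → ℤ} (hη : Fin.tail η ≠ ξ) : coeff η g = 0 := by
  obtain ⟨j, hj⟩ := Function.ne_iff.1 hη
  have h1 := coeff_D j.succ g η
  rw [hg j, map_smul, smul_eq_mul] at h1
  have h2 : ((ξ j : ℂ) - η j.succ) * coeff η g = 0 := by rw [sub_mul, h1, sub_self]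
  refine (mul_eq_zero.1 h2).resolve_left (sub_ne_zero.2 ?_)
  exact_mod_cast Ne.symm hj

theorem hasSpatialFreq_of_coeff {g : TorusSmooth (N + 1)} {ξ : Fin N → ℤ}
    (hg : ∀ η : Fin (N + 1) → ℤ, Fin.tail η ≠ ξ → coeff η g = 0) : HasSpatialFreq g ξ := by
  refine fun j => ext_coeff fun η => ?_
  rw [coeff_D, map_smul, smul_eq_mul]
  by_cases h : Fin.tail η = ξ
  · rw [← h]
    rfl
  · rw [hg η h, mul_zero, mul_zero]

end TorusSmooth

namespace TorusDistribution

open TorusSmooth (HasSpatialFreq)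

/-- The distribution `u` is the weak sum of the smooth functions `g i`. -/
def IsSumOf {n : ℕ} {ι : Type*} (u : TorusDistribution n) (g : ι → TorusSmooth n) : Prop :=
  ∀ φ, HasSum (fun i => ofSmooth (g i) φ) (u φ)

variable {N : ℕ} {ι : Type*}

/-- Bounded functions with distinct spatial frequencies can be summed to a distribution. -/
theorem exists_isSumOf {g : ι → TorusSmooth (N + 1)} {ξ : ι → Fin N → ℤ}
    (hξ : Function.Injective ξ) (hg : ∀ i, HasSpatialFreq (g i) (ξ i))
    (hb : ∀ i, TorusSmooth.seminorm (N + 1) 0 (g i) ≤ 1) :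
    ∃ u : TorusDistribution (N + 1), IsSumOf u g := by
  set K := 2 * N
  set A : ℝ := 2 ^ K * (2 * Real.pi) ^ (N + 1)
  have hA : 0 ≤ A := by positivity
  have hS : Summable fun i => ((1 + ‖ξ i‖) ^ K)⁻¹ :=
    (summable_inv_one_add_norm_pow N).comp_injective hξ
  have hle : ∀ φ i, ‖ofSmooth (g i) φ‖ ≤ ((1 + ‖ξ i‖) ^ K)⁻¹ *
      (A * (TorusSmooth.seminorm (N + 1) 0 φ + TorusSmooth.seminorm (N + 1) K φ)) := by
    intro φ i
    rw [le_inv_mul_iff₀ (by positivity)]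
    refine (one_add_norm_pow_mul_ofSmooth_le (e := Fin.succ) (hg i) K φ).trans ?_
    have h1 : 0 ≤ TorusSmooth.seminorm (N + 1) 0 φ := apply_nonneg _ _
    have h2 : 0 ≤ TorusSmooth.seminorm (N + 1) K φ := apply_nonneg _ _
    exact mul_le_mul_of_nonneg_right (mul_le_of_le_one_right hA (hb i)) (add_nonneg h1 h2)
  have hs : ∀ φ, Summable fun i => ofSmooth (g i) φ := fun φ =>
    Summable.of_norm_bounded (hS.mul_right _) (hle φ)
  let l : TorusSmooth (N + 1) →ₗ[ℂ] ℂ :=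
    { toFun := fun φ => ∑' i, ofSmooth (g i) φ
      map_add' := fun φ ψ => by
        simp only [map_add]
        exact (hs φ).tsum_add (hs ψ)
      map_smul' := fun z φ => by
        simp only [map_smul, smul_eq_mul, RingHom.id_apply]
        exact tsum_mul_left }
  set S := ∑' i, ((1 + ‖ξ i‖) ^ K)⁻¹
  have hS0 : 0 ≤ S := tsum_nonneg fun i => by positivity
  refine ⟨⟨l, ?_⟩, fun φ => (hs φ).hasSum⟩
  refine WithSeminorms.continuous_normedSpace_rng ℂ (TorusSmooth.withSeminorms (N + 1)) _
    ⟨{0, K}, ⟨S * (A * 2), by positivity⟩, fun φ => ?_⟩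
  have h1 : TorusSmooth.seminorm (N + 1) 0 φ ≤
      (({0, K} : Finset ℕ).sup (TorusSmooth.seminorm (N + 1))) φ :=
    Seminorm.le_def.1 (Finset.le_sup (f := TorusSmooth.seminorm (N + 1)) (by simp)) φ
  have h2 : TorusSmooth.seminorm (N + 1) K φ ≤
      (({0, K} : Finset ℕ).sup (TorusSmooth.seminorm (N + 1))) φ :=
    Seminorm.le_def.1 (Finset.le_sup (f := TorusSmooth.seminorm (N + 1)) (by simp)) φ
  have h3 : ‖l φ‖ ≤ S *
      (A * (TorusSmooth.seminorm (N + 1) 0 φ + TorusSmooth.seminorm (N + 1) K φ)) :=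
    tsum_of_norm_bounded (hS.hasSum.mul_right _) (hle φ)
  calc ‖l φ‖ ≤ S * (A * (2 * (({0, K} : Finset ℕ).sup (TorusSmooth.seminorm (N + 1))) φ)) := by
        refine h3.trans ?_
        gcongr
        linarith
    _ = S * (A * 2) * (({0, K} : Finset ℕ).sup (TorusSmooth.seminorm (N + 1))) φ := by ring

theorem IsSumOf.hasSum_coeff {n : ℕ} {u : TorusDistribution n} {g : ι → TorusSmooth n}
    (hu : IsSumOf u g) (η : Fin n → ℤ) :
    HasSum (fun i => TorusSmooth.coeff η (g i)) (coeff u η) := by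
  simp only [← TorusSmooth.coeff_ofSmooth]
  exact (hu _).mul_left _

section

variable {u : TorusDistribution (N + 1)} {g : ι → TorusSmooth (N + 1)} {ξ : ι → Fin N → ℤ}

theorem IsSumOf.coeff_eq (hu : IsSumOf u g) (hξ : Function.Injective ξ)
    (hg : ∀ i, HasSpatialFreq (g i) (ξ i)) {η : Fin (N + 1) → ℤ} {i : ι} (hi : Fin.tail η = ξ i) :
    coeff u η = TorusSmooth.coeff η (g i) :=
  (hu.hasSum_coeff η).unique (hasSum_single i fun i' hi' =>
    (hg i').coeff_eq_zero fun h => hi' (hξ (h.symm.trans hi)))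

theorem IsSumOf.coeff_eq_zero (hu : IsSumOf u g) (hg : ∀ i, HasSpatialFreq (g i) (ξ i))
    {η : Fin (N + 1) → ℤ} (hη : Fin.tail η ∉ Set.range ξ) : coeff u η = 0 := by
  have h := hu.hasSum_coeff η
  have h0 : ∀ i, TorusSmooth.coeff η (g i) = 0 := fun i =>
    (hg i).coeff_eq_zero fun h => hη ⟨i, h.symm⟩
  simp only [h0] at h
  exact h.unique hasSum_zero

/-- If a sum of functions with distinct spatial frequencies is smooth, then the sup norms of these
functions are summable. -/
theorem IsSumOf.summable_seminorm {f : TorusSmooth (N + 1)} (hu : IsSumOf (ofSmooth f) g)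
    (hξ : Function.Injective ξ) (hg : ∀ i, HasSpatialFreq (g i) (ξ i)) :
    Summable fun i => TorusSmooth.seminorm (N + 1) 0 (g i) := by
  have hs : Summable fun η => ‖TorusSmooth.coeff η f‖ := by
    simpa using f.rapidDecay_coeff.summable 0
  have hinj : Function.Injective fun p : ι × ℤ => (Fin.cons p.2 (ξ p.1) : Fin (N + 1) → ℤ) := by
    rintro ⟨i, k⟩ ⟨i', k'⟩ h
    obtain ⟨h1, h2⟩ := Fin.cons_injective2 h
    exact Prod.ext (hξ h2) h1
  refine (hs.comp_injective hinj).prod.of_nonneg_of_le (fun i => apply_nonneg _ _) fun i => ?_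
  refine (g i).seminorm_zero_le_tsum_coeff.trans (le_of_eq ?_)
  have hc : Function.Injective fun k : ℤ => (Fin.cons k (ξ i) : Fin (N + 1) → ℤ) := fun k k' h =>
    (Fin.cons_injective2 h).1
  rw [← hc.tsum_eq (f := fun η => ‖TorusSmooth.coeff η (g i)‖)]
  · refine tsum_congr fun k => ?_
    have h := hu.coeff_eq hξ hg (η := Fin.cons k (ξ i)) (Fin.tail_cons _ _)
    rw [TorusSmooth.coeff_ofSmooth] at h
    simp only [Function.comp_apply, h]
  · intro η hη
    by_contra h
    refine hη ?_
    have : Fin.tail η ≠ ξ i := fun h' => h ⟨η 0, by simp only [← h', Fin.cons_self_tail]⟩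
    simp only [(hg i).coeff_eq_zero this, norm_zero]

end

end TorusDistribution

/-! ### Tube operators acting on smooth functions -/

section Tube

open TorusSmooth TorusDistribution

variable {N : ℕ}

/-- The operator `L - λ` on smooth functions. -/
def smoothTube (c : Fin N → TorusSmooth 1) (lam f : TorusSmooth (N + 1)) : TorusSmooth (N + 1) :=
  TorusSmooth.D 0 f + ∑ j, ofTime (c j) * TorusSmooth.D j.succ f - lam * f

theorem perturbedTubeOperator_ofSmooth (c : Fin N → TorusSmooth 1) (lam f : TorusSmooth (N + 1)) :
    perturbedTubeOperator c lam (ofSmooth f) = ofSmooth (smoothTube c lam f) := by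
  ext φ
  rw [ofSmooth_comm (smoothTube c lam f)]
  simp only [perturbedTubeOperator, tubeOperator, smoothTube, D_ofSmooth, mul_ofSmooth, map_sub,
    map_add, map_sum, _root_.sub_apply, _root_.add_apply, _root_.sum_apply]
  simp only [ofSmooth_comm φ]

theorem tubeOperator_eq (c : Fin N → TorusSmooth 1) :
    tubeOperator c = perturbedTubeOperator c 0 := by
  funext u
  ext φ
  simp [perturbedTubeOperator]

theorem perturbedTubeOperator_apply (c : Fin N → TorusSmooth 1) (lam : TorusSmooth (N + 1))
    (u : TorusDistribution (N + 1)) (φ : TorusSmooth (N + 1)) :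
    perturbedTubeOperator c lam u φ =
      u (-TorusSmooth.D 0 φ - ∑ j, TorusSmooth.D j.succ (ofTime (c j) * φ) - lam * φ) := by
  simp [perturbedTubeOperator, tubeOperator, sub_eq_add_neg]

theorem TorusDistribution.IsSumOf.perturbedTubeOperator {ι : Type*}
    {u : TorusDistribution (N + 1)} {g : ι → TorusSmooth (N + 1)} (hu : IsSumOf u g)
    (c : Fin N → TorusSmooth 1) (lam : TorusSmooth (N + 1)) :
    IsSumOf (perturbedTubeOperator c lam u) fun i => smoothTube c lam (g i) := by
  intro φ
  simp only [← perturbedTubeOperator_ofSmooth, perturbedTubeOperator_apply]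
  exact hu _

theorem smoothTube_smul (c : Fin N → TorusSmooth 1) (lam f : TorusSmooth (N + 1)) (z : ℂ) :
    smoothTube c lam (z • f) = z • smoothTube c lam f := by
  simp only [smoothTube, map_smul, mul_smul_comm, Finset.smul_sum, smul_add, smul_sub]

theorem smoothTube_add (c : Fin N → TorusSmooth 1) (lam f g : TorusSmooth (N + 1)) :
    smoothTube c lam (f + g) = smoothTube c lam f + smoothTube c lam g := by
  simp only [smoothTube, map_add, mul_add, Finset.sum_add_distrib]
  abel

theorem smoothTube_sum (c : Fin N → TorusSmooth 1) (lam : TorusSmooth (N + 1)) {ι : Type*}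
    (s : Finset ι) (f : ι → TorusSmooth (N + 1)) :
    smoothTube c lam (∑ i ∈ s, f i) = ∑ i ∈ s, smoothTube c lam (f i) :=
  map_sum (AddMonoidHom.mk' (smoothTube c lam) (smoothTube_add c lam)) f s

/-- The symbol `τ + ∑_j α_j ξ_j` of the operator `D_t + ∑_j α_j D_{x_j}` at `η = (τ, ξ)`. -/
def symbol (α : Fin N → ℂ) (η : Fin (N + 1) → ℤ) : ℂ := η 0 + ∑ j, α j * η j.succ

theorem exists_primitive (c : Fin N → TorusSmooth 1) :
    ∃ b : Fin N → TorusSmooth 1, ∀ j, TorusSmooth.D 0 (b j) =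
      algebraMap ℂ (TorusSmooth 1) (c j).mean - c j := by
  have h : ∀ j, ∃ b : TorusSmooth 1, TorusSmooth.D 0 b =
      algebraMap ℂ (TorusSmooth 1) (c j).mean - c j := fun j =>
    exists_D_eq_of_mean_eq_zero _ (by
      rw [mean_eq_coeff, map_sub, ← mean_eq_coeff, ← mean_eq_coeff, mean_algebraMap, sub_self])
  choose b hb using h
  exact ⟨b, hb⟩

/-- The integrating factor `exp(∑_j ξ_j b_j(t))`. -/
def phase (b : Fin N → TorusSmooth 1) (ξ : Fin N → ℤ) : TorusSmooth (N + 1) :=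
  texp (∑ j, (ξ j : ℂ) • ofTime (b j))

theorem D_succ_phase (b : Fin N → TorusSmooth 1) (ξ : Fin N → ℤ) (j : Fin N) :
    TorusSmooth.D j.succ (phase b ξ) = 0 := by
  simp [phase, D_texp, D_ofTime_succ]

theorem phase_neg (b : Fin N → TorusSmooth 1) (ξ : Fin N → ℤ) :
    phase b ξ * phase b (-ξ) = 1 := by
  have : ∑ j, ((-ξ) j : ℂ) • (ofTime (b j) : TorusSmooth (N + 1)) =
      -∑ j, (ξ j : ℂ) • ofTime (b j) := by
    simp [Finset.sum_neg_distrib]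
  rw [phase, phase, this, texp_mul_texp_neg]

theorem ofTime_sub (a b : TorusSmooth 1) :
    (ofTime (a - b) : TorusSmooth (N + 1)) = ofTime a - ofTime b := rfl

theorem ofTime_algebraMap (z : ℂ) :
    (ofTime (algebraMap ℂ (TorusSmooth 1) z) : TorusSmooth (N + 1)) =
      algebraMap ℂ (TorusSmooth (N + 1)) z := rfl

variable {c b : Fin N → TorusSmooth 1}

theorem D_zero_phase (hb : ∀ j, TorusSmooth.D 0 (b j) =
      algebraMap ℂ (TorusSmooth 1) (c j).mean - c j) (ξ : Fin N → ℤ) :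
    TorusSmooth.D 0 (phase b ξ) =
      (∑ j, (ξ j : ℂ) • (algebraMap ℂ (TorusSmooth (N + 1)) (c j).mean - ofTime (c j))) *
        phase b ξ := by
  simp only [phase, D_texp, map_sum, map_smul, D_ofTime_zero, hb, ofTime_sub, ofTime_algebraMap]

/-- The integrating factor conjugates the action of `L` on functions of spatial frequency `ξ` to
that of a constant-coefficient operator. -/
theorem smoothTube_phase_mul (hb : ∀ j, TorusSmooth.D 0 (b j) =
      algebraMap ℂ (TorusSmooth 1) (c j).mean - c j) {ξ : Fin N → ℤ} {v : TorusSmooth (N + 1)}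
    (hv : HasSpatialFreq v ξ) (z : ℂ) :
    smoothTube c (algebraMap ℂ _ z) (phase b ξ * v) =
      phase b ξ * (TorusSmooth.D 0 v + (∑ j, (c j).mean * ξ j - z) • v) := by
  simp only [smoothTube, TorusSmooth.D_mul, D_zero_phase hb, D_succ_phase, hv _, zero_mul, zero_add]
  ext x
  have hsum : ∀ (f : Fin N → TorusSmooth (N + 1)) (x : Fin (N + 1) → ℝ),
      (∑ j, f j) x = ∑ j, f j x := fun f x =>
    map_sum (AddMonoidHom.mk' (fun f : TorusSmooth (N + 1) => f x) fun _ _ => rfl) f _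
  simp only [TorusSmooth.add_apply, TorusSmooth.sub_apply, TorusSmooth.mul_apply,
    TorusSmooth.smul_apply, hsum, TorusSmooth.algebraMap_apply]
  have e : ∑ j, (ξ j : ℂ) * ((c j).mean - ofTime (c j) x) +
      ∑ j, ofTime (c j) x * ξ j = ∑ j, (c j).mean * ξ j := by
    rw [← Finset.sum_add_distrib]
    exact Finset.sum_congr rfl fun j _ => by ring
  have e2 : ∑ j, ofTime (c j) x * (phase b ξ x * ((ξ j : ℂ) * v x)) =
      (∑ j, ofTime (c j) x * ξ j) * (phase b ξ x * v x) := by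
    rw [Finset.sum_mul]
    exact Finset.sum_congr rfl fun j _ => by ring
  rw [e2, ← e]
  ring

end Tube

section Symbol

open TorusSmooth TorusDistribution

variable {N : ℕ}

/-! ### Small denominators and the failure of global hypoellipticity -/

/-- For every `K`, there are infinitely many `η ∈ ℤ^{N+1}` such that
`|τ + ∑_j α_j ξ_j - z| < (1 + ‖η‖)^{-K}`. -/
def SmallDenominators (α : Fin N → ℂ) (z : ℂ) : Prop :=
  ∀ K : ℕ, {η : Fin (N + 1) → ℤ | ‖symbol α η - z‖ < ((1 + ‖η‖) ^ K)⁻¹}.Infinite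

theorem finite_setOf_norm_intCast_add_lt (a : ℂ) (R : ℝ) : {k : ℤ | ‖(k : ℂ) + a‖ < R}.Finite := by
  refine (Set.finite_Icc (-⌈R + ‖a‖⌉) ⌈R + ‖a‖⌉).subset fun k hk => ?_
  rw [Set.mem_Icc, ← abs_le]
  have h1 : ‖(k : ℂ)‖ ≤ ‖(k : ℂ) + a‖ + ‖a‖ := by
    simpa using norm_sub_le ((k : ℂ) + a) a
  rw [Complex.norm_intCast] at h1
  have h2 : (|k| : ℝ) ≤ R + ‖a‖ := by
    have : ‖(k : ℂ) + a‖ < R := hk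
    linarith
  exact_mod_cast h2.trans (Int.le_ceil _)

/-- Small denominators occur along a sequence of pairwise distinct spatial frequencies. -/
theorem SmallDenominators.exists_seq {α : Fin N → ℂ} {z : ℂ} (h : SmallDenominators α z) :
    ∃ η : ℕ → Fin (N + 1) → ℤ, (Function.Injective fun m => Fin.tail (η m)) ∧
      ∀ m, ‖symbol α (η m) - z‖ < ((1 + ‖η m‖) ^ m)⁻¹ := by
  obtain ⟨p, hp, hp'⟩ := exists_seq_of_forall_finset_exists
    (fun p : ℕ × (Fin (N + 1) → ℤ) => ‖symbol α p.2 - z‖ < ((1 + ‖p.2‖) ^ p.1)⁻¹)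
    (fun p q => p.1 < q.1 ∧ Fin.tail p.2 ≠ Fin.tail q.2) (fun s _ => by
      -- For each fixed spatial frequency, only finitely many `τ` give a small symbol.
      have hfin : {η : Fin (N + 1) → ℤ | ‖symbol α η - z‖ < 1 ∧
          Fin.tail η ∈ (fun p : ℕ × (Fin (N + 1) → ℤ) => Fin.tail p.2) '' s}.Finite := by
        refine (((s.finite_toSet.image fun p : ℕ × (Fin (N + 1) → ℤ) => Fin.tail p.2).biUnion
          fun ξ _ => (finite_setOf_norm_intCast_add_lt (∑ j, α j * ξ j - z) 1).image
            fun k => (Fin.cons k ξ : Fin (N + 1) → ℤ))).subset ?_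
        rintro η ⟨h1, h2⟩
        refine Set.mem_biUnion h2 ⟨η 0, ?_, Fin.cons_self_tail η⟩
        rw [symbol, add_sub_assoc] at h1
        exact h1
      obtain ⟨η, hη, hη'⟩ := (h (s.sup Prod.fst + 1)).exists_notMem_finite hfin
      refine ⟨(s.sup Prod.fst + 1, η), hη, fun q hq => ⟨?_, fun hq' => hη' ⟨?_, q, hq, hq'⟩⟩⟩
      · exact Nat.lt_succ_of_le (Finset.le_sup (f := Prod.fst) hq)
      · refine lt_of_lt_of_le hη (inv_le_one_of_one_le₀ (one_le_pow₀ ?_))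
        linarith [norm_nonneg η])
  have hm : StrictMono fun m => (p m).1 := fun m m' h => (hp' m m' h).1
  refine ⟨fun m => (p m).2, fun m m' hmm => ?_, fun m => (hp m).trans_le ?_⟩
  · by_contra hne
    rcases lt_or_gt_of_ne hne with hlt | hlt
    · exact (hp' m m' hlt).2 hmm
    · exact (hp' m' m hlt).2 hmm.symm
  · refine inv_anti₀ (by positivity) (pow_le_pow_right₀ ?_ (hm.le_apply))
    linarith [norm_nonneg (p m).2]

/-- Eigenfunctions of `L`: functions `g_η` of sup norm one and spatial frequency `ξ` such that
`L g_η = (τ + c₀·ξ) g_η`, where `η = (τ, ξ)`, with derivatives of order `k` of size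
`O((1 + ‖η‖)^k)`. They are the multiples of `e^{i η·x}` by the integrating factors. -/
theorem exists_eigenfunctions (c : Fin N → TorusSmooth 1) :
    ∃ g : (Fin (N + 1) → ℤ) → TorusSmooth (N + 1),
      (∀ η, HasSpatialFreq (g η) (Fin.tail η)) ∧
      (∀ η, TorusSmooth.seminorm (N + 1) 0 (g η) = 1) ∧
      (∀ η z, smoothTube c (algebraMap ℂ _ z) (g η) =
        (symbol (fun j => (c j).mean) η - z) • g η) ∧
      ∀ k, ∃ C : ℝ, 0 ≤ C ∧ ∀ η, TorusSmooth.seminorm (N + 1) k (g η) ≤ C * (1 + ‖η‖) ^ k := by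
  obtain ⟨b, hb⟩ := exists_primitive c
  let G : (Fin (N + 1) → ℤ) → TorusSmooth (N + 1) := fun η => phase b (Fin.tail η) * character η
  let κ : (Fin (N + 1) → ℤ) → ℂ := fun η => ((TorusSmooth.seminorm (N + 1) 0 (G η) : ℝ) : ℂ)⁻¹
  have hG0 : ∀ η, 0 < TorusSmooth.seminorm (N + 1) 0 (G η) := fun η => by
    refine lt_of_lt_of_le ?_ ((G η).norm_apply_le 0)
    rw [norm_pos_iff]
    exact mul_ne_zero (Complex.exp_ne_zero _) (Complex.exp_ne_zero _)
  have hGf : ∀ η, HasSpatialFreq (G η) (Fin.tail η) := fun η =>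
    (hasSpatialFreq_character η).mul fun j => D_succ_phase b _ j
  have hn : ∀ η, TorusSmooth.seminorm (N + 1) 0 (κ η • G η) = 1 := fun η => by
    rw [map_smul_eq_mul, norm_inv, Complex.norm_real, Real.norm_of_nonneg (hG0 η).le]
    exact inv_mul_cancel₀ (hG0 η).ne'
  refine ⟨fun η => κ η • G η, fun η => (hGf η).smul _, hn, fun η z => ?_, fun k => ?_⟩
  · rw [smoothTube_smul, smul_comm]
    congr 1
    change smoothTube c _ (phase b (Fin.tail η) * character η) = _
    rw [smoothTube_phase_mul hb (hasSpatialFreq_character η) z, TorusSmooth.D_character, ← add_smul,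
      mul_smul_comm, symbol, add_sub_assoc]
    rfl
  -- The derivatives of `g_η` are multiples `β_j g_η` with `β_j` affine in `η`; the normalising
  -- constant, which may grow exponentially in `η`, does not enter.
  · let e : Fin N → TorusSmooth (N + 1) := fun j =>
      algebraMap ℂ (TorusSmooth (N + 1)) (c j).mean - ofTime (c j)
    let β : (Fin (N + 1) → ℤ) → Fin (N + 1) → TorusSmooth (N + 1) := fun η =>
      Fin.cons (((η 0 : ℤ) : ℂ) • 1 + ∑ j : Fin N, (η j.succ : ℂ) • e j)
        fun j => ((η j.succ : ℤ) : ℂ) • 1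
    have hβ : ∀ η j, TorusSmooth.D j (κ η • G η) = β η j * (κ η • G η) := by
      intro η j
      rw [map_smul, mul_smul_comm]
      congr 1
      refine Fin.cases ?_ (fun j => ?_) j
      · change TorusSmooth.D 0 (phase b (Fin.tail η) * character η) =
          (((η 0 : ℤ) : ℂ) • 1 + ∑ j : Fin N, (η j.succ : ℂ) • e j) *
            (phase b (Fin.tail η) * character η)
        rw [TorusSmooth.D_mul, D_zero_phase hb, TorusSmooth.D_character, add_mul, smul_mul_assoc,
          one_mul, mul_smul_comm, mul_assoc]
        exact add_comm _ _
      · change _ = ((η j.succ : ℤ) : ℂ) • 1 * G η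
        rw [hGf η j, smul_mul_assoc, one_mul]
        rfl
    obtain ⟨C, hC0, hC⟩ := exists_seminorm_le_of_D_eq_mul (n := N + 1)
      (fun i => TorusSmooth.seminorm (N + 1) i 1 + ∑ j, TorusSmooth.seminorm (N + 1) i (e j)) k
    refine ⟨C, hC0, fun η => ?_⟩
    have h1 : ∀ j, ‖((η j : ℤ) : ℂ)‖ ≤ 1 + ‖η‖ := fun j => by
      rw [Complex.norm_intCast, ← Int.norm_eq_abs]
      linarith [norm_le_pi_norm η j]
    have hT : 0 ≤ 1 + ‖η‖ := by positivity
    have h := hC (κ η • G η) (β η) (1 + ‖η‖) (by linarith [norm_nonneg η]) (hβ η) (fun j i => by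
      have hp0 : 0 ≤ TorusSmooth.seminorm (N + 1) i 1 := apply_nonneg _ _
      have hp : 0 ≤ ∑ j, TorusSmooth.seminorm (N + 1) i (e j) :=
        Finset.sum_nonneg fun j _ => apply_nonneg _ _
      have hs : ∀ j, TorusSmooth.seminorm (N + 1) i (((η j : ℤ) : ℂ) • 1) ≤
          TorusSmooth.seminorm (N + 1) i 1 * (1 + ‖η‖) := fun j => by
        rw [map_smul_eq_mul, mul_comm]
        exact mul_le_mul_of_nonneg_left (h1 j) hp0
      refine Fin.cases ?_ (fun j => ?_) j
      · refine (map_add_le_add _ _ _).trans ?_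
        rw [add_mul]
        refine add_le_add (hs 0) ?_
        refine (Finset.le_sum_of_subadditive _ (map_zero _).le (map_add_le_add _) _ _).trans ?_
        rw [Finset.sum_mul]
        refine Finset.sum_le_sum fun j _ => ?_
        rw [map_smul_eq_mul, mul_comm]
        exact mul_le_mul_of_nonneg_left (h1 j.succ) (apply_nonneg _ _)
      · refine (hs j.succ).trans (mul_le_mul_of_nonneg_right ?_ hT)
        linarith)
    rwa [hn, mul_one] at h

/-- Small denominators obstruct the global hypoellipticity of `L - z`: a sum of eigenfunctions with
eigenvalues rapidly approaching `z` is a singular distribution with smooth image. -/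
theorem SmallDenominators.not_isGloballyHypoelliptic {c : Fin N → TorusSmooth 1} {z : ℂ}
    (h : SmallDenominators (fun j => (c j).mean) z) :
    ¬ IsGloballyHypoelliptic (perturbedTubeOperator c (algebraMap ℂ (TorusSmooth (N + 1)) z)) := by
  intro hGH
  obtain ⟨η, hinj, hη⟩ := h.exists_seq
  obtain ⟨g, hg, hg1, hgL, hgk⟩ := exists_eigenfunctions c
  obtain ⟨v, hv⟩ := exists_isSumOf hinj (fun m => hg (η m)) (fun m => (hg1 (η m)).le)
  have hPv := hv.perturbedTubeOperator c (algebraMap ℂ _ z)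
  simp only [hgL] at hPv
  have hfreq := fun m => (hg (η m)).smul (symbol (fun j => (c j).mean) (η m) - z)
  obtain ⟨f, hf⟩ := hGH v (mem_range_ofSmooth_of_rapidDecay fun K => by
    obtain ⟨C, hC0, hC⟩ := hgk K
    -- The `m`-th eigenvalue is `O((1 + ‖η_m‖)^{-m})`: only the terms with `m < K` can exceed `1`.
    set B : ℝ := 1 + ∑ m ∈ Finset.range K, (1 + ‖η m‖) ^ K
    have hB : ∀ m, ‖symbol (fun j => (c j).mean) (η m) - z‖ * (1 + ‖η m‖) ^ K ≤ B := by
      intro m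
      have h1 : (1 : ℝ) ≤ 1 + ‖η m‖ := by linarith [norm_nonneg (η m)]
      have hsum : 0 ≤ ∑ m ∈ Finset.range K, (1 + ‖η m‖) ^ K :=
        Finset.sum_nonneg fun m _ => by positivity
      rcases le_or_gt K m with hm | hm
      · have : ‖symbol (fun j => (c j).mean) (η m) - z‖ * (1 + ‖η m‖) ^ K ≤ 1 := by
          rw [← le_div_iff₀ (by positivity), one_div]
          refine (hη m).le.trans (inv_anti₀ (by positivity) (pow_le_pow_right₀ h1 hm))
        linarith
      · have h2 : ‖symbol (fun j => (c j).mean) (η m) - z‖ ≤ 1 :=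
          (hη m).le.trans (inv_le_one_of_one_le₀ (one_le_pow₀ h1))
        have h3 := Finset.single_le_sum (f := fun m => (1 + ‖η m‖) ^ K)
          (fun m _ => by positivity) (Finset.mem_range.2 hm)
        have h4 := mul_le_of_le_one_left (b := (1 + ‖η m‖) ^ K) (by positivity) h2
        linarith
    have hB0 : 0 ≤ B := (mul_nonneg (norm_nonneg _) (by positivity)).trans (hB 0)
    refine ⟨2 ^ K * ((1 + C) * B), fun ζ => ?_⟩
    by_cases hζ : Fin.tail ζ ∈ Set.range fun m => Fin.tail (η m)
    · obtain ⟨m, hm⟩ := hζ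
      have h1 : (1 : ℝ) ≤ (1 + ‖η m‖) ^ K := one_le_pow₀ (by linarith [norm_nonneg (η m)])
      rw [hPv.coeff_eq hinj hfreq hm.symm, map_smul, norm_smul, mul_left_comm]
      calc _ ≤ ‖symbol (fun j => (c j).mean) (η m) - z‖ *
            (2 ^ K * (1 + C * (1 + ‖η m‖) ^ K)) := by
            have h2 := one_add_norm_pow_mul_coeff_le K (g (η m)) ζ
            rw [hg1] at h2
            refine mul_le_mul_of_nonneg_left (h2.trans ?_) (norm_nonneg _)
            gcongr
            exact hC _
        _ ≤ ‖symbol (fun j => (c j).mean) (η m) - z‖ *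
            (2 ^ K * ((1 + ‖η m‖) ^ K + C * (1 + ‖η m‖) ^ K)) := by gcongr
        _ = 2 ^ K * ((1 + C) * (‖symbol (fun j => (c j).mean) (η m) - z‖ * (1 + ‖η m‖) ^ K)) := by
            ring
        _ ≤ _ := by gcongr; exact hB m
    · rw [hPv.coeff_eq_zero hfreq hζ, norm_zero, mul_zero]
      positivity)
  subst hf
  have hs := hv.summable_seminorm hinj (fun m => hg (η m))
  simp only [hg1] at hs
  exact one_ne_zero ((summable_const_iff (1 : ℝ)).1 hs)

theorem coeff_perturbedTubeOperator_algebraMap (α : Fin N → ℂ) (z : ℂ)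
    (u : TorusDistribution (N + 1)) (η : Fin (N + 1) → ℤ) :
    TorusDistribution.coeff (perturbedTubeOperator (fun j => algebraMap ℂ (TorusSmooth 1) (α j))
      (algebraMap ℂ (TorusSmooth (N + 1)) z) u) η =
      (symbol α η - z) * TorusDistribution.coeff u η := by
  simp only [perturbedTubeOperator, tubeOperator, ofTime_algebraMap, TorusDistribution.coeff_sub,
    TorusDistribution.coeff_add, TorusDistribution.coeff_sum, coeff_mul_algebraMap,
    TorusDistribution.coeff_D, symbol, add_mul, sub_mul, Finset.sum_mul, mul_assoc]

/-- A constant-coefficient operator fails to be globally hypoelliptic exactly when it has small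
denominators. -/
theorem not_isGloballyHypoelliptic_algebraMap_iff (α : Fin N → ℂ) (z : ℂ) :
    ¬ IsGloballyHypoelliptic (perturbedTubeOperator (fun j => algebraMap ℂ (TorusSmooth 1) (α j))
      (algebraMap ℂ (TorusSmooth (N + 1)) z)) ↔ SmallDenominators α z := by
  refine ⟨fun h => ?_, fun h => ?_⟩
  · by_contra hs
    refine h fun u hu => ?_
    obtain ⟨f, hf⟩ := hu
    simp only [SmallDenominators, not_forall, Set.not_infinite] at hs
    obtain ⟨K, hK⟩ := hs
    refine mem_range_ofSmooth_of_rapidDecay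
      (f.rapidDecay_coeff.of_norm_le_off_finite 1 K hK fun η hη => ?_)
    rw [Set.mem_ofPred_eq, not_lt] at hη
    have hpos : 0 < (1 + ‖η‖) ^ K := by positivity
    rw [← TorusSmooth.coeff_ofSmooth, hf, coeff_perturbedTubeOperator_algebraMap, norm_mul, one_mul,
      ← mul_assoc]
    refine le_mul_of_one_le_left (norm_nonneg _) ?_
    calc (1 : ℝ) = (1 + ‖η‖) ^ K * ((1 + ‖η‖) ^ K)⁻¹ := (mul_inv_cancel₀ hpos.ne').symm
      _ ≤ _ := by gcongr
  · have h' : SmallDenominators (fun j => (algebraMap ℂ (TorusSmooth 1) (α j)).mean) z := by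
      simpa only [mean_algebraMap] using h
    exact h'.not_isGloballyHypoelliptic

theorem mem_averagedNonGHConstants_iff (c : Fin N → TorusSmooth 1) (z : ℂ) :
    z ∈ averagedNonGHConstants c ↔ SmallDenominators (fun j => (c j).mean) z :=
  not_isGloballyHypoelliptic_algebraMap_iff _ z

end Symbol

section Solve

open TorusSmooth TorusDistribution

variable {N : ℕ}

/-! ### Solvability on smooth functions of a globally hypoelliptic operator -/

theorem exists_norm_inv_intCast_add_le (a : ℂ) : ∃ C : ℝ, ∀ k : ℤ, ‖((k : ℂ) + a)⁻¹‖ ≤ C := by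
  have hfin := finite_setOf_norm_intCast_add_lt a 1
  have hsum : ∀ s : Finset ℤ, 0 ≤ ∑ k ∈ s, ‖((k : ℂ) + a)⁻¹‖ := fun s =>
    Finset.sum_nonneg fun _ _ => norm_nonneg _
  refine ⟨1 + ∑ k ∈ hfin.toFinset, ‖((k : ℂ) + a)⁻¹‖, fun k => ?_⟩
  by_cases hk : ‖(k : ℂ) + a‖ < 1
  · have := Finset.single_le_sum (f := fun k : ℤ => ‖((k : ℂ) + a)⁻¹‖)
      (fun k _ => norm_nonneg _) (hfin.mem_toFinset.2 hk)
    linarith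
  · rw [norm_inv]
    have := inv_le_one_of_one_le₀ (not_lt.1 hk)
    linarith [hsum hfin.toFinset]

/-- A nonzero spatial frequency `ξ` with `c₀·ξ ∈ ℤ` produces, through its multiples, infinitely many
zeros of the symbol. -/
theorem IsGloballyHypoelliptic.intCast_add_sum_ne_zero {c : Fin N → TorusSmooth 1}
    (hL : IsGloballyHypoelliptic (tubeOperator c)) {ξ : Fin N → ℤ} (hξ : ξ ≠ 0) (k : ℤ) :
    (k : ℂ) + ∑ j, (c j).mean * ξ j ≠ 0 := by
  intro h0
  have hs : SmallDenominators (fun j => (c j).mean) 0 := by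
    intro K
    refine Set.infinite_of_injective_forall_mem
      (f := fun m : ℕ => (m : ℤ) • (Fin.cons k ξ : Fin (N + 1) → ℤ)) (fun m m' hm => ?_)
      (fun m => ?_)
    · obtain ⟨j, hj⟩ := Function.ne_iff.1 hξ
      have h1 := congrFun hm j.succ
      simp only [Pi.smul_apply, Fin.cons_succ, smul_eq_mul] at h1
      exact_mod_cast mul_right_cancel₀ hj h1
    · have : symbol (fun j => (c j).mean) ((m : ℤ) • (Fin.cons k ξ : Fin (N + 1) → ℤ)) = 0 := by
        rw [← mul_zero (m : ℂ), ← h0]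
        simp only [symbol, Pi.smul_apply, Fin.cons_succ, Fin.cons_zero, smul_eq_mul, mul_add,
          Finset.mul_sum]
        push_cast
        congr 1
        exact Finset.sum_congr rfl fun j _ => by ring
      rw [Set.mem_ofPred_eq, this, sub_zero, norm_zero]
      positivity
  refine hs.not_isGloballyHypoelliptic ?_
  rwa [map_zero, ← tubeOperator_eq]

/-- Solution of `L u = F` for a right-hand side `F` with a single spatial frequency: the integrating
factor reduces it to division by the symbol on the Fourier side. -/
theorem exists_smoothTube_eq_of_hasSpatialFreq (c : Fin N → TorusSmooth 1) {ξ : Fin N → ℤ}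
    {F : TorusSmooth (N + 1)} (hF : HasSpatialFreq F ξ)
    (hξ : ξ ≠ 0 → ∀ k : ℤ, (k : ℂ) + ∑ j, (c j).mean * ξ j ≠ 0) (h0 : ξ = 0 → mean F = 0) :
    ∃ u, HasSpatialFreq u ξ ∧ smoothTube c 0 u = F := by
  obtain ⟨b, hb⟩ := exists_primitive c
  set a := ∑ j, (c j).mean * ξ j
  set h := phase b (-ξ) * F
  have hfreq : HasSpatialFreq h ξ := hF.mul fun j => D_succ_phase b _ j
  obtain ⟨C, hC⟩ := exists_norm_inv_intCast_add_le a
  obtain ⟨v, hv⟩ := exists_coeff_eq_mul (fun η => ((η 0 : ℂ) + a)⁻¹) C (fun η => hC (η 0)) h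
  have hvfreq : HasSpatialFreq v ξ := hasSpatialFreq_of_coeff fun η hη => by
    rw [hv, hfreq.coeff_eq_zero hη, mul_zero]
  have hvh : TorusSmooth.D 0 v + a • v = h := by
    refine ext_coeff fun η => ?_
    rw [map_add, TorusSmooth.coeff_D, map_smul, smul_eq_mul, ← add_mul, hv]
    -- The symbol can only vanish at `η = 0`, where the right-hand side has no coefficient.
    by_cases hη : (η 0 : ℂ) + a = 0
    · rw [hη, zero_mul]
      by_cases ht : Fin.tail η = ξ
      · have hξ0 : ξ = 0 := by
          by_contra hne
          exact hξ hne (η 0) hη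
        have ha : a = 0 := by simp [a, hξ0]
        have hη0 : η 0 = 0 := by simpa [ha] using hη
        have hη' : η = 0 := by
          rw [← Fin.cons_self_tail η, hη0, ht, hξ0]
          exact funext fun i => Fin.cases rfl (fun _ => rfl) i
        have hh : h = F := by
          ext x
          simp [h, hξ0, phase]
        rw [hη', hh, ← mean_eq_coeff, h0 hξ0]
      · rw [hfreq.coeff_eq_zero ht]
    · rw [← mul_assoc, mul_inv_cancel₀ hη, one_mul]
  refine ⟨phase b ξ * v, hvfreq.mul fun j => D_succ_phase b _ j, ?_⟩
  have key := smoothTube_phase_mul hb hvfreq 0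
  rw [map_zero, sub_zero, hvh, ← mul_assoc, phase_neg, one_mul] at key
  exact key

/-- The range of a globally hypoelliptic `L` contains the smooth functions of mean zero. After
solving separately for each spatial frequency, the solutions `u_ξ` are damped to have norm at most
`1`, so that they sum to a distribution whose image under `L` is smooth; by hypoellipticity the
damped solutions tend to zero, hence only finitely many of them were really damped. -/
theorem IsGloballyHypoelliptic.exists_smoothTube_eq {c : Fin N → TorusSmooth 1}
    (hL : IsGloballyHypoelliptic (tubeOperator c)) {f : TorusSmooth (N + 1)} (hf : mean f = 0) :
    ∃ w, smoothTube c 0 w = f := by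
  classical
  have hF : ∀ ξ : Fin N → ℤ, ∃ F : TorusSmooth (N + 1), ∀ η, coeff η F =
      (if Fin.tail η = ξ then 1 else 0) * coeff η f := fun ξ =>
    exists_coeff_eq_mul _ 1 (fun η => by split_ifs <;> simp) f
  choose F hF using hF
  have hFfreq : ∀ ξ, HasSpatialFreq (F ξ) ξ := fun ξ => hasSpatialFreq_of_coeff fun η hη => by
    rw [hF, if_neg hη, zero_mul]
  have hu : ∀ ξ, ∃ u, HasSpatialFreq u ξ ∧ smoothTube c 0 u = F ξ := fun ξ =>
    exists_smoothTube_eq_of_hasSpatialFreq c (hFfreq ξ)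
      (fun hξ k => hL.intCast_add_sum_ne_zero hξ k) (fun hξ => by
        rw [mean_eq_coeff, hF, ← mean_eq_coeff, hf, mul_zero])
  choose u hufreq huF using hu
  -- The damping factors.
  let r : (Fin N → ℤ) → ℝ := fun ξ => (max 1 (TorusSmooth.seminorm (N + 1) 0 (u ξ)))⁻¹
  have hmax : ∀ ξ, 1 ≤ max 1 (TorusSmooth.seminorm (N + 1) 0 (u ξ)) := fun ξ => le_max_left _ _
  have hr0 : ∀ ξ, 0 ≤ r ξ := fun ξ => inv_nonneg.2 (zero_le_one.trans (hmax ξ))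
  have hr1 : ∀ ξ, r ξ ≤ 1 := fun ξ => inv_le_one_of_one_le₀ (hmax ξ)
  have hsn : ∀ ξ, TorusSmooth.seminorm (N + 1) 0 ((r ξ : ℂ) • u ξ) =
      r ξ * TorusSmooth.seminorm (N + 1) 0 (u ξ) := fun ξ => by
    rw [map_smul_eq_mul, Complex.norm_real, Real.norm_of_nonneg (hr0 ξ)]
  obtain ⟨v, hv⟩ := exists_isSumOf Function.injective_id (fun ξ => (hufreq ξ).smul (r ξ))
    (fun ξ => by
      rw [hsn, inv_mul_le_iff₀ (zero_lt_one.trans_le (hmax ξ)), mul_one]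
      exact le_max_right _ _)
  have hPv := hv.perturbedTubeOperator c 0
  simp only [smoothTube_smul, huF] at hPv
  have hc : ∀ η, TorusDistribution.coeff (perturbedTubeOperator c 0 v) η =
      r (Fin.tail η) * coeff η f := fun η => by
    rw [hPv.coeff_eq Function.injective_id (fun ξ => (hFfreq ξ).smul (r ξ)) (i := Fin.tail η) rfl,
      map_smul, hF, if_pos rfl, one_mul, smul_eq_mul]
  obtain ⟨v', hv'⟩ := hL v (by
    rw [tubeOperator_eq]
    refine mem_range_ofSmooth_of_rapidDecay (f.rapidDecay_coeff.of_norm_le 1 0 fun η => ?_)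
    rw [hc, norm_mul, Complex.norm_real, Real.norm_of_nonneg (hr0 _), pow_zero, mul_one]
    exact mul_le_mul_of_nonneg_right (hr1 _) (norm_nonneg _))
  subst hv'
  have hsum := hv.summable_seminorm Function.injective_id (fun ξ => (hufreq ξ).smul (r ξ))
  simp only [hsn] at hsum
  have hfin : {ξ | ¬ r ξ * TorusSmooth.seminorm (N + 1) 0 (u ξ) < 1}.Finite :=
    hsum.tendsto_cofinite_zero.eventually_lt_const one_pos
  have hr : ∀ ξ ∉ hfin.toFinset, r ξ = 1 := fun ξ hξ => by
    rw [hfin.mem_toFinset, Set.mem_ofPred_eq, not_not] at hξ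
    rcases le_total (TorusSmooth.seminorm (N + 1) 0 (u ξ)) 1 with h | h
    · simp only [r, max_eq_left h, inv_one]
    · simp only [r, max_eq_right h] at hξ
      rw [inv_mul_cancel₀ (zero_lt_one.trans_le h).ne'] at hξ
      exact absurd hξ (lt_irrefl _)
  -- The damping is undone at the finitely many frequencies where it took place.
  refine ⟨v' + ∑ ξ ∈ hfin.toFinset, (1 - r ξ : ℂ) • u ξ, ext_coeff fun η => ?_⟩
  have h1 : coeff η (smoothTube c 0 v') = r (Fin.tail η) * coeff η f := by
    rw [← hc, perturbedTubeOperator_ofSmooth, TorusSmooth.coeff_ofSmooth]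
  rw [smoothTube_add, smoothTube_sum, map_add, h1, map_sum]
  simp only [smoothTube_smul, huF, map_smul, hF, smul_eq_mul]
  by_cases hη : Fin.tail η ∈ hfin.toFinset
  · rw [Finset.sum_eq_single (Fin.tail η) (fun ξ _ hξ => by simp [hξ.symm])
      (fun h => absurd hη h)]
    simp only [if_true]
    ring
  · rw [hr _ hη, Finset.sum_eq_zero (fun ξ hξ => by
      rw [if_neg (fun h => hη (by rwa [h])), zero_mul, mul_zero])]
    simp

/-! ### Conjugation to a constant perturbation -/

/-- If `L h = λ - z` then `(L - λ) e^h = e^h (L - z)`. -/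
theorem perturbedTubeOperator_mul_texp {c : Fin N → TorusSmooth 1} {lam h : TorusSmooth (N + 1)}
    {z : ℂ} (hh : smoothTube c 0 h = lam - algebraMap ℂ _ z) (u : TorusDistribution (N + 1)) :
    perturbedTubeOperator c lam (mul (texp h) u) =
      mul (texp h) (perturbedTubeOperator c (algebraMap ℂ _ z) u) := by
  ext φ
  have e : TorusSmooth.D 0 h * texp h * φ +
      ∑ j, TorusSmooth.D j.succ h * texp h * (ofTime (c j) * φ) =
      texp h * (lam * φ) - algebraMap ℂ _ z * (texp h * φ) := by
    have : smoothTube c 0 h * (texp h * φ) = (lam - algebraMap ℂ _ z) * (texp h * φ) := by rw [hh]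
    simp only [smoothTube, zero_mul, sub_zero, add_mul, Finset.sum_mul] at this
    calc _ = _ := by
          congr 1
          · ring
          · exact Finset.sum_congr rfl fun j _ => by ring
      _ = _ := this
      _ = _ := by ring
  have e' := congrArg u e
  rw [map_add, map_sub, map_sum] at e'
  simp only [perturbedTubeOperator, tubeOperator, TorusDistribution.D_mul, D_texp,
    _root_.sub_apply, _root_.add_apply, _root_.sum_apply, TorusDistribution.mul_apply,
    Finset.sum_add_distrib]
  have e3 : ∀ j : Fin N, ofTime (c j) * (texp h * φ) = texp h * (ofTime (c j) * φ) := fun j => by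
    ring
  simp only [e3]
  linear_combination e'

theorem meanNonGHPerturbations_subset {c : Fin N → TorusSmooth 1}
    (hL : IsGloballyHypoelliptic (tubeOperator c)) :
    meanNonGHPerturbations c ⊆ nonGHPerturbations c := by
  intro lam hlam hGH
  have hs := (mem_averagedNonGHConstants_iff c lam.mean).1 hlam
  obtain ⟨h, hh⟩ := hL.exists_smoothTube_eq (f := lam - algebraMap ℂ _ lam.mean) (by
    rw [mean_eq_coeff, map_sub, ← mean_eq_coeff, ← mean_eq_coeff, mean_algebraMap, sub_self])
  refine hs.not_isGloballyHypoelliptic fun u hu => ?_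
  obtain ⟨f, hf⟩ := hu
  obtain ⟨g, hg⟩ := hGH (mul (texp h) u) ⟨texp h * f, by
    rw [perturbedTubeOperator_mul_texp hh, ← hf, mul_ofSmooth]⟩
  refine ⟨texp (-h) * g, ?_⟩
  rw [← mul_ofSmooth, hg]
  ext φ
  rw [TorusDistribution.mul_apply, TorusDistribution.mul_apply, ← mul_assoc, texp_mul_texp_neg,
    one_mul]

end Solve

/-! ### Points that are approximated infinitely often -/

section InfinitelyApproximated

variable {X ι : Type*} [PseudoMetricSpace X] (p : ι → X) (r : ℕ → ι → ℝ)

theorem setOf_forall_infinite_eq :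
    {x | ∀ K, {i | dist (p i) x < r K i}.Infinite} =
      ⋂ q : ℕ × Finset ι, ⋃ i ∈ (q.2 : Set ι)ᶜ, Metric.ball (p i) (r q.1 i) := by
  ext x
  simp only [Set.mem_ofPred_eq, Set.mem_iInter, Set.mem_iUnion, Metric.mem_ball, Set.mem_compl_iff,
    Prod.forall, SetLike.mem_coe, exists_prop]
  refine forall_congr' fun K => ⟨fun h s => ?_, fun h hfin => ?_⟩
  · obtain ⟨i, hi, his⟩ := h.exists_notMem_finset s
    exact ⟨i, his, by rwa [dist_comm]⟩
  · obtain ⟨i, his, hi⟩ := h hfin.toFinset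
    exact his (hfin.mem_toFinset.2 (by rwa [Set.mem_ofPred_eq, dist_comm]))

theorem isGδ_setOf_forall_infinite [Countable ι] :
    IsGδ {x | ∀ K, {i | dist (p i) x < r K i}.Infinite} := by
  rw [setOf_forall_infinite_eq]
  exact IsGδ.iInter_of_isOpen fun q => isOpen_biUnion fun i _ => Metric.isOpen_ball

theorem dense_setOf_forall_infinite [Countable ι] [T1Space X] [BaireSpace X]
    [∀ x : X, (nhdsWithin x {x}ᶜ).NeBot] (hp : DenseRange p) (hr : ∀ K i, 0 < r K i) :
    Dense {x | ∀ K, {i | dist (p i) x < r K i}.Infinite} := by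
  rw [setOf_forall_infinite_eq]
  refine dense_iInter_of_isOpen (fun q => isOpen_biUnion fun i _ => Metric.isOpen_ball) fun q => ?_
  refine (hp.sdiff_finite (q.2.finite_toSet.image p)).mono ?_
  rintro _ ⟨⟨i, rfl⟩, hi⟩
  exact Set.mem_biUnion (x := i) (fun h => hi ⟨i, h, rfl⟩) (Metric.mem_ball_self (hr _ _))

end InfinitelyApproximated

/-! ### Kronecker's density theorem -/

section Kronecker

open MeasureTheory

/-- The integral of a nontrivial character against a translation-invariant measure vanishes. -/
theorem integral_eq_zero_of_translation {K : Type*} [AddGroup K] [TopologicalSpace K]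
    [IsTopologicalAddGroup K] [MeasurableSpace K] [BorelSpace K] (μ : Measure K)
    [μ.IsAddLeftInvariant] {χ : K → ℂ} {a : K} (hχ : ∀ x, χ (a + x) = χ a * χ x) (ha : χ a ≠ 1) :
    ∫ x, χ x ∂μ = 0 := by
  have h := integral_add_left_eq_self (μ := μ) χ a
  simp only [hχ, integral_const_mul] at h
  have h2 : (χ a - 1) * ∫ x, χ x ∂μ = 0 := by rw [sub_mul, h, one_mul, sub_self]
  exact (mul_eq_zero.1 h2).resolve_left (sub_ne_zero.2 ha)

variable {d : Type*} [Fintype d]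

theorem mFourier_apply_add (η : d → ℤ) (x y : UnitAddTorus d) :
    UnitAddTorus.mFourier η (x + y) = UnitAddTorus.mFourier η x * UnitAddTorus.mFourier η y := by
  simp only [UnitAddTorus.mFourier, ContinuousMap.coe_mk, Pi.add_apply,
    ← Finset.prod_mul_distrib, fourier_apply, smul_add, AddCircle.toCircle_add, Circle.coe_mul]

/-- A finite measure on the torus is determined by its Fourier coefficients. -/
theorem measure_ext_of_mFourier {μ ν : Measure (UnitAddTorus d)} [IsFiniteMeasure μ]
    [IsFiniteMeasure ν]
    (h : ∀ η : d → ℤ, ∫ x, UnitAddTorus.mFourier η x ∂μ = ∫ x, UnitAddTorus.mFourier η x ∂ν) :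
    μ = ν := by
  have key : ∀ g ∈ UnitAddTorus.mFourierSubalgebra d, ∫ x, g x ∂μ = ∫ x, g x ∂ν := by
    intro g hg
    have hi : ∀ (m : Measure (UnitAddTorus d)) [IsFiniteMeasure m] (g : C(UnitAddTorus d, ℂ)),
        Integrable g m := fun m _ g =>
      g.continuous.integrable_of_hasCompactSupport (HasCompactSupport.of_compactSpace _)
    have hg' : g ∈ Submodule.span ℂ (Set.range (UnitAddTorus.mFourier (d := d))) := by
      rw [← UnitAddTorus.mFourierSubalgebra_coe]
      exact hg
    clear hg
    induction hg' using Submodule.span_induction with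
    | mem g hg => obtain ⟨η, rfl⟩ := hg; exact h η
    | zero => simp
    | add f g _ _ hf hg =>
      simp only [ContinuousMap.add_apply]
      rw [integral_add (hi μ f) (hi μ g), integral_add (hi ν f) (hi ν g), hf, hg]
    | smul z f _ hf =>
      simp only [ContinuousMap.smul_apply, integral_smul, hf]
  refine ext_of_forall_mem_subalgebra_integral_eq_of_polish (𝕜 := ℂ)
    (A := (UnitAddTorus.mFourierSubalgebra d).comap
      (BoundedContinuousFunction.toContinuousMapStarₐ ℂ)) ?_ (fun g hg => key _ hg)
  intro x y hxy
  obtain ⟨_, ⟨g, hg, rfl⟩, hgxy⟩ := UnitAddTorus.mFourierSubalgebra_separatesPoints hxy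
  exact ⟨_, ⟨g, ⟨BoundedContinuousFunction.mkOfCompact g, hg, rfl⟩, rfl⟩, hgxy⟩

/-- A subgroup of the torus that is not annihilated by any nontrivial character is dense: the Haar
measure of its closure has the same Fourier coefficients as the Haar measure of the torus. -/
theorem dense_of_forall_exists_mFourier_ne_one (H : AddSubgroup (UnitAddTorus d))
    (h : ∀ η : d → ℤ, η ≠ 0 → ∃ x ∈ H, UnitAddTorus.mFourier η x ≠ 1) :
    Dense (H : Set (UnitAddTorus d)) := by
  let K := H.topologicalClosure
  have hK : IsClosed (K : Set (UnitAddTorus d)) := H.isClosed_topologicalClosure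
  have : CompactSpace K := isCompact_iff_compactSpace.1 hK.isCompact
  let μ : Measure K := Measure.addHaarMeasure ⊤
  let ν : Measure (UnitAddTorus d) := Measure.addHaarMeasure ⊤
  have : IsProbabilityMeasure μ := ⟨Measure.addHaarMeasure_self⟩
  have : IsProbabilityMeasure ν := ⟨Measure.addHaarMeasure_self⟩
  have hval : Measurable (Subtype.val : K → UnitAddTorus d) := measurable_subtype_coe
  have : IsProbabilityMeasure (μ.map Subtype.val) :=
    Measure.isProbabilityMeasure_map hval.aemeasurable
  have hμν : μ.map Subtype.val = ν := by
    refine measure_ext_of_mFourier fun η => ?_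
    rw [integral_map hval.aemeasurable (ContinuousMap.continuous _).aestronglyMeasurable]
    by_cases hη : η = 0
    · subst hη
      simp [UnitAddTorus.mFourier_zero]
    · obtain ⟨a, haH, ha⟩ := h η hη
      rw [integral_eq_zero_of_translation ν (fun x => mFourier_apply_add η a x) ha]
      exact integral_eq_zero_of_translation μ (a := ⟨a, H.le_topologicalClosure haH⟩)
        (χ := fun x : K => UnitAddTorus.mFourier η x) (fun x => mFourier_apply_add η a x) ha
  -- The complement of `K` is an open set of Haar measure zero.
  have h0 : ν (K : Set (UnitAddTorus d))ᶜ = 0 := by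
    have he : ((↑) ⁻¹' (K : Set (UnitAddTorus d))ᶜ : Set K) = ∅ :=
      Set.eq_empty_iff_forall_notMem.2 fun x hx => hx x.2
    rw [← hμν, Measure.map_apply hval hK.measurableSet.compl, he, measure_empty]
  have h1 := (hK.isOpen_compl.measure_eq_zero_iff ν).1 h0
  rw [Set.compl_empty_iff] at h1
  rw [dense_iff_closure_eq]
  exact h1

/-- A subgroup `Γ` of `ℝᵈ` containing `ℤᵈ` is dense if no nonzero integral linear form takes integer
values on it. -/
theorem dense_of_forall_exists_not_int (Γ : AddSubgroup (d → ℝ))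
    (hZ : ∀ m : d → ℤ, (fun i => (m i : ℝ)) ∈ Γ)
    (h : ∀ η : d → ℤ, η ≠ 0 → ∃ x ∈ Γ, ∀ m : ℤ, ∑ i, (η i : ℝ) * x i ≠ m) :
    Dense (Γ : Set (d → ℝ)) := by
  let q : (d → ℝ) →+ UnitAddTorus d :=
    { toFun := fun x i => (x i : UnitAddCircle)
      map_zero' := rfl
      map_add' := fun _ _ => rfl }
  have hq : IsOpenQuotientMap q :=
    IsOpenQuotientMap.piMap fun _ : d => QuotientAddGroup.isOpenQuotientMap_mk
  have hd : Dense ((Γ.map q : AddSubgroup (UnitAddTorus d)) : Set (UnitAddTorus d)) := by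
    refine dense_of_forall_exists_mFourier_ne_one _ fun η hη => ?_
    obtain ⟨x, hx, hm⟩ := h η hη
    refine ⟨q x, ⟨x, hx, rfl⟩, fun h1 => ?_⟩
    change UnitAddTorus.mFourier η (fun i => (x i : UnitAddCircle)) = 1 at h1
    simp only [UnitAddTorus.mFourier, ContinuousMap.coe_mk, fourier_coe_apply,
      ← Complex.exp_sum] at h1
    obtain ⟨m, hm'⟩ := Complex.exp_eq_one_iff.1 h1
    refine hm m ?_
    have h2 : (2 * Real.pi * Complex.I : ℂ) ≠ 0 := Complex.two_pi_I_ne_zero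
    have h3 : (2 * Real.pi * Complex.I : ℂ) * ∑ i, (η i : ℂ) * (x i : ℂ) =
        2 * Real.pi * Complex.I * m := by
      rw [mul_comm _ (m : ℂ), ← hm', Finset.mul_sum]
      refine Finset.sum_congr rfl fun i _ => ?_
      push_cast
      ring
    exact_mod_cast mul_left_cancel₀ h2 h3
  refine (hq.dense_preimage_iff.2 hd).mono ?_
  rintro x ⟨y, hy, hxy⟩
  have h1 : ∀ i, ∃ m : ℤ, (m : ℝ) = x i - y i := fun i => by
    have h2 : ((x i - y i : ℝ) : UnitAddCircle) = 0 := by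
      rw [AddCircle.coe_sub, sub_eq_zero]
      exact (congrFun hxy i).symm
    obtain ⟨m, hm⟩ := AddCircle.coe_eq_zero_iff 1 |>.1 h2
    exact ⟨m, by rwa [zsmul_eq_mul, mul_one] at hm⟩
  choose m hm using h1
  have : x = (fun i => (m i : ℝ)) + y := by
    funext i
    rw [Pi.add_apply, hm]
    ring
  rw [this]
  exact Γ.add_mem (hZ m) hy

end Kronecker

section Averaged

open TorusSmooth

variable {N : ℕ}

/-! ### Density of the range of the symbol -/

theorem symbol_add (α : Fin N → ℂ) (η ζ : Fin (N + 1) → ℤ) :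
    symbol α (η + ζ) = symbol α η + symbol α ζ := by
  simp only [symbol, Pi.add_apply, Int.cast_add, mul_add, Finset.sum_add_distrib]
  ring

theorem symbol_single_zero (α : Fin N → ℂ) (k : ℤ) :
    symbol α (Pi.single 0 k) = k := by
  simp [symbol, Fin.succ_ne_zero]

theorem symbol_single_succ (α : Fin N → ℂ) (j : Fin N) (k : ℤ) :
    symbol α (Pi.single j.succ k) = k * α j := by
  rw [symbol, Finset.sum_eq_single j (fun i _ hi => by
    rw [Pi.single_eq_of_ne (by simpa using hi), Int.cast_zero, mul_zero]) (by simp)]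
  rw [Pi.single_eq_same, Pi.single_eq_of_ne (Fin.succ_ne_zero j).symm, Int.cast_zero, zero_add,
    mul_comm]

/-- The symbol as a homomorphism. -/
def symbolHom (α : Fin N → ℂ) : (Fin (N + 1) → ℤ) →+ ℂ := AddMonoidHom.mk' (symbol α) (symbol_add α)

theorem denseRange_re_symbol {α : Fin N → ℂ} {k : Fin N} (hk : Irrational (α k).re) :
    DenseRange fun η => (symbol α η).re := by
  have h : Dense (AddSubgroup.closure {(α k).re, 1} : Set ℝ) :=
    dense_addSubgroupClosure_pair_iff.2 (by rwa [div_one])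
  let l : (Fin (N + 1) → ℤ) →+ ℝ := Complex.reAddGroupHom.comp (symbolHom α)
  refine h.mono ?_
  change (_ : Set ℝ) ⊆ (l.range : Set ℝ)
  rw [SetLike.coe_subset_coe, AddSubgroup.closure_le, Set.insert_subset_iff,
    Set.singleton_subset_iff]
  refine ⟨⟨Pi.single k.succ 1, ?_⟩, ⟨Pi.single 0 1, ?_⟩⟩
  · change (symbol α _).re = _
    rw [symbol_single_succ, Int.cast_one, one_mul]
  · change (symbol α _).re = _
    rw [symbol_single_zero, Int.cast_one, Complex.one_re]

/-- In the real coordinates of `ℂ` with respect to the basis `(1, α_k)`, the range of the symbol is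
generated by `ℤ²` and the columns of `(Im α_k)⁻¹ C`. -/
theorem denseRange_symbol {α : Fin N → ℂ} {k : Fin N} (hk : (α k).im ≠ 0)
    (hK : KroneckerCondition α k) : DenseRange (symbol α) := by
  let ψ : (Fin 2 → ℝ) →+ ℂ :=
    AddMonoidHom.mk' (fun x => (x 0 : ℂ) + x 1 * α k) fun x y => by
      simp only [Pi.add_apply, Complex.ofReal_add]
      ring
  have hψc : Continuous ψ := by
    change Continuous fun x : Fin 2 → ℝ => (x 0 : ℂ) + x 1 * α k
    fun_prop
  have hcoord : ∀ z : ℂ, ψ ![z.re - z.im / (α k).im * (α k).re, z.im / (α k).im] = z := fun z => by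
    change ((z.re - z.im / (α k).im * (α k).re : ℝ) : ℂ) + ((z.im / (α k).im : ℝ) : ℂ) * α k = z
    apply Complex.ext
    · simp
    · simp [hk]
  have hψs : Function.Surjective ψ := fun z => ⟨_, hcoord z⟩
  let Γ : AddSubgroup (Fin 2 → ℝ) := (symbolHom α).range.comap ψ
  have hΓ : Dense (Γ : Set (Fin 2 → ℝ)) := by
    refine dense_of_forall_exists_not_int Γ (fun m => ?_) fun η hη => ?_
    · refine ⟨Pi.single 0 (m 0) + Pi.single k.succ (m 1), ?_⟩
      change symbol α _ = ((m 0 : ℝ) : ℂ) + ((m 1 : ℝ) : ℂ) * α k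
      rw [symbol_add, symbol_single_zero, symbol_single_succ]
      push_cast
      rfl
    · by_contra! hcon
      have hr : (fun i => (η i : ℚ)) ∈ {r : Fin 2 → ℚ | ∀ j, ∃ q : ℚ, ((α k).im⁻¹ •
          (kroneckerMatrix α k).transpose.mulVec (fun i => (r i : ℝ))) j = (q : ℝ)} := by
        rintro ⟨j, hj⟩
        obtain ⟨m, hm⟩ := hcon ![(α j).re - (α j).im / (α k).im * (α k).re, (α j).im / (α k).im]
          ⟨Pi.single j.succ 1, by
            change symbol α _ = _
            rw [symbol_single_succ, hcoord, Int.cast_one, one_mul]⟩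
        refine ⟨m, ?_⟩
        rw [Rat.cast_intCast, ← hm]
        simp [kroneckerMatrix, Matrix.mulVec, dotProduct, Fin.sum_univ_two]
        field_simp
      rw [KroneckerCondition] at hK
      rw [hK, Set.mem_singleton_iff] at hr
      exact hη (funext fun i => by simpa using congrFun hr i)
  have h2 := hψs.denseRange.dense_image hψc hΓ
  refine h2.mono ?_
  rintro _ ⟨x, ⟨η, hη⟩, rfl⟩
  exact ⟨η, hη⟩

/-! ### The exceptional set -/

theorem inv_one_add_norm_pow_pos (K : ℕ) (η : Fin (N + 1) → ℤ) : 0 < ((1 + ‖η‖) ^ K)⁻¹ := by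
  positivity

theorem setOf_smallDenominators_eq (α : Fin N → ℂ) :
    {z | SmallDenominators α z} =
      {z | ∀ K : ℕ, {η | dist (symbol α η) z < ((1 + ‖η‖) ^ K)⁻¹}.Infinite} := by
  simp only [SmallDenominators, dist_eq_norm]

theorem im_eq_zero_of_smallDenominators {α : Fin N → ℂ} (hα : ∀ j, (α j).im = 0) {z : ℂ}
    (h : SmallDenominators α z) : z.im = 0 := by
  by_contra hz
  have hfin : (Metric.closedBall (0 : Fin (N + 1) → ℤ) |z.im|⁻¹).Finite :=
    (isCompact_closedBall _ _).finite_of_discrete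
  refine h 1 (hfin.subset fun η hη => ?_)
  rw [Set.mem_ofPred_eq, pow_one] at hη
  have him : (symbol α η - z).im = -z.im := by simp [symbol, hα]
  have h1 := Complex.abs_im_le_norm (symbol α η - z)
  rw [him, abs_neg] at h1
  have h2 := (le_inv_comm₀ (abs_pos.2 hz) (by positivity)).1 (h1.trans hη.le)
  rw [mem_closedBall_zero_iff]
  linarith

theorem dense_setOf_smallDenominators_ofReal {α : Fin N → ℂ} (hα : ∀ j, (α j).im = 0) {k : Fin N}
    (hk : Irrational (α k).re) : Dense {x : ℝ | SmallDenominators α x} := by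
  have h := dense_setOf_forall_infinite (fun η => (symbol α η).re)
    (fun K η => ((1 + ‖η‖) ^ K)⁻¹) (denseRange_re_symbol hk) inv_one_add_norm_pow_pos
  have hn : ∀ (x : ℝ) η, ‖symbol α η - x‖ = dist (symbol α η).re x := fun x η => by
    rw [dist_eq_norm, ← Complex.norm_real]
    congr 1
    apply Complex.ext
    · simp
    · simp [symbol, hα]
  simpa only [SmallDenominators, hn] using h

theorem continuous_mean (n : ℕ) : Continuous (mean : TorusSmooth n → ℂ) := by
  rw [show (mean : TorusSmooth n → ℂ) = coeff 0 from funext mean_eq_coeff]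
  exact (coeff 0).continuous

theorem mean_add_algebraMap {n : ℕ} (f : TorusSmooth n) (z : ℂ) :
    mean (f + algebraMap ℂ _ (z - mean f)) = z := by
  rw [mean_eq_coeff, map_add, ← mean_eq_coeff, ← mean_eq_coeff, mean_algebraMap, add_sub_cancel]

theorem continuous_add_algebraMap {n : ℕ} (f : TorusSmooth n) :
    Continuous fun z : ℂ => f + algebraMap ℂ (TorusSmooth n) (z - mean f) := by
  simp only [Algebra.algebraMap_eq_smul_one]
  exact continuous_const.add ((continuous_id.sub continuous_const).smul continuous_const)

theorem meanNonGHPerturbations_eq (c : Fin N → TorusSmooth 1) :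
    meanNonGHPerturbations c = mean ⁻¹' {z | SmallDenominators (fun j => (c j).mean) z} :=
  Set.ext fun lam => mem_averagedNonGHConstants_iff c lam.mean

theorem isGδ_meanNonGHPerturbations (c : Fin N → TorusSmooth 1) :
    IsGδ (meanNonGHPerturbations c) := by
  rw [meanNonGHPerturbations_eq, setOf_smallDenominators_eq]
  exact (isGδ_setOf_forall_infinite _ _).preimage (continuous_mean _)

theorem dense_meanNonGHPerturbations {c : Fin N → TorusSmooth 1} {k : Fin N}
    (hk : (c k).mean.im ≠ 0) (hK : KroneckerCondition (fun j => (c j).mean) k) :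
    Dense (meanNonGHPerturbations c) := by
  have hd : Dense {z | SmallDenominators (fun j => (c j).mean) z} := by
    rw [setOf_smallDenominators_eq]
    exact dense_setOf_forall_infinite _ _ (denseRange_symbol hk hK) inv_one_add_norm_pow_pos
  intro lam
  have h := image_closure_subset_closure_image (continuous_add_algebraMap lam)
    (Set.mem_image_of_mem _ (hd lam.mean))
  simp only [sub_self, map_zero, add_zero] at h
  refine closure_mono ?_ h
  rintro _ ⟨z, hz, rfl⟩
  rw [meanNonGHPerturbations_eq, Set.mem_preimage, mean_add_algebraMap]
  exact hz

theorem dense_preimage_meanNonGHPerturbations {c : Fin N → TorusSmooth 1}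
    (hc : ∀ j, (c j).mean.im = 0) {k : Fin N} (hk : Irrational (c k).mean.re) :
    Dense ((↑) ⁻¹' meanNonGHPerturbations c : Set (realMeanPerturbations N)) := by
  have hd := dense_setOf_smallDenominators_ofReal hc hk
  rintro ⟨lam, hlam⟩
  let m : ℝ → realMeanPerturbations N := fun x =>
    ⟨lam + algebraMap ℂ _ (x - mean lam), by
      change (mean _).im = 0
      rw [mean_add_algebraMap, Complex.ofReal_im]⟩
  have hm : Continuous m :=
    ((continuous_add_algebraMap lam).comp Complex.continuous_ofReal).subtype_mk _
  have h := image_closure_subset_closure_image hm (Set.mem_image_of_mem _ (hd lam.mean.re))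
  have e : m lam.mean.re = ⟨lam, hlam⟩ := by
    have h0 : ((lam.mean.re : ℝ) : ℂ) = lam.mean := Complex.ext rfl (Eq.symm hlam)
    refine Subtype.ext ?_
    change lam + algebraMap ℂ _ ((lam.mean.re : ℂ) - mean lam) = lam
    rw [h0, sub_self, map_zero, add_zero]
  rw [e] at h
  refine closure_mono ?_ h
  rintro _ ⟨x, hx, rfl⟩
  change lam + algebraMap ℂ _ ((x : ℂ) - mean lam) ∈ meanNonGHPerturbations c
  rw [meanNonGHPerturbations_eq, Set.mem_preimage, mean_add_algebraMap]
  exact hx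

end Averaged
end

theorem mainTheorem2 (N : ℕ) (c : Fin N → TorusSmooth 1) :
    (IsGloballyHypoelliptic (tubeOperator c) →
      meanNonGHPerturbations c ⊆ nonGHPerturbations c) ∧
    ((∀ j, (c j).mean.im = 0) → (∃ k, Irrational (c k).mean.re) →
      meanNonGHPerturbations c ⊆ realMeanPerturbations N ∧
      IsGδ ((↑) ⁻¹' meanNonGHPerturbations c : Set (realMeanPerturbations N)) ∧
      Dense ((↑) ⁻¹' meanNonGHPerturbations c : Set (realMeanPerturbations N))) ∧
    ((∃ k, (c k).mean.im ≠ 0 ∧ KroneckerCondition (fun j => (c j).mean) k) →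
      IsGδ (meanNonGHPerturbations c) ∧ Dense (meanNonGHPerturbations c)) := by
  refine ⟨meanNonGHPerturbations_subset, fun hc ⟨k, hk⟩ => ⟨fun lam hlam => ?_, ?_, ?_⟩,
    fun ⟨k, hk, hK⟩ => ⟨isGδ_meanNonGHPerturbations c, dense_meanNonGHPerturbations hk hK⟩⟩
  · exact im_eq_zero_of_smallDenominators hc ((mem_averagedNonGHConstants_iff c _).1 hlam)
  · exact (isGδ_meanNonGHPerturbations c).preimage continuous_subtype_val
  · exact dense_preimage_meanNonGHPerturbations hc hk
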